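/- Let $1\le d<n$, let $\mathbb T=\mathbb R/2\pi\mathbb Z$ and $\Omega=\mathbb T^d\times\mathbb R^{n-d}$, with Haar measure $dy$ (normalized on $\mathbb T^d$, Lebesgue on $\mathbb R^{n-d}$), and let $\Omega^*=\mathbb Z^d\times\mathbb R^{n-d}\subset\mathbb R^n$ with $d\xi$ the product of counting and Lebesgue measure. For $m\in\mathbb R$ let $S^m(\Omega)$ be the class of functions $a\in C^\infty(\Omega\times\Omega\times\mathbb R^n;\mathbb C)$ such that $$\sup_{x,y\in\Omega,\ \xi\in\mathbb R^n}(1+|\xi|)^{|\gamma|-m}\,|\partial_x^\alpha\partial_y^\beta\partial_\xi^\gamma a(x,y,\xi)|<\infty\qquad\text{for all } |\alpha|,|\beta|,|\gamma|\le n+1 .$$ **Theorem 2.1.** Let $m<0$ and $a\in S^m(\Omega)$, and suppose that for every $R>0$ $$\lim_{x,y\to\infty,\ |x-y|<R}\ \ \sup_{\xi\in\mathbb R^n,\ |\alpha|\le n+1}(1+|\xi|)^{|\alpha|+m}\,|\partial_\xi^\alpha a(x,y,\xi)|=0 .$$ Then the pseudo-differential operator with amplitude $a$, $$Au(x)=\int_{\Omega^*}\int_\Omega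 a(x,y,\xi)\,e^{i(x-y)\cdot\xi}\,u(y)\,dy\,d\xi ,$$ is compact on $L^2(\Omega)$. That is, for every Schwartz function $u$ on $\Omega$ (smooth, with all derivatives decaying rapidly in the variables of $\mathbb R^{n-d}$) and every $x\in\Omega$ the iterated integral converges (the inner integrand is integrable over $\Omega$ for each $\xi\in\Omega^*$, and the inner integral is integrable over $\Omega^*$), and there is a compact bounded linear operator $T$ on $L^2(\Omega)=L^2(\Omega;\mathbb C)$ with $Tu=Au$ almost everywhere for all such $u$. -/

import Mathlib

open MeasureTheory Filter Topology
open scoped ContDiff ENNReal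

noncomputable section

namespace MixedPDO

instance fact_two_pi_pos : Fact (0 < 2 * Real.pi) := ⟨Real.two_pi_pos⟩

/-- The mixed domain `Ω = 𝕋^d × ℝ^k` (so `n = d + k`); the circle has period `2π`. -/
abbrev Omega (d k : ℕ) : Type :=
  (Fin d → AddCircle (2 * Real.pi)) × EuclideanSpace ℝ (Fin k)

/-- `ℝ^n` with its Euclidean norm. -/
abbrev Eucl (n : ℕ) : Type := EuclideanSpace ℝ (Fin n)

/-- The dual group `Ω^* = ℤ^d × ℝ^k`. -/
abbrev OmegaDual (d k : ℕ) : Type := (Fin d → ℤ) × EuclideanSpace ℝ (Fin k)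

/-- Haar measure on `Ω`: normalized Lebesgue measure on `𝕋^d` times Lebesgue measure on `ℝ^k`. -/
abbrev omegaMeasure (d k : ℕ) : Measure (Omega d k) :=
  (Measure.pi fun _ : Fin d => (AddCircle.haarAddCircle : Measure (AddCircle (2 * Real.pi)))).prod
    volume

/-- Haar measure on `Ω^*`: counting measure on `ℤ^d` times Lebesgue measure on `ℝ^k`. -/
abbrev dualMeasure (d k : ℕ) : Measure (OmegaDual d k) :=
  (Measure.count : Measure (Fin d → ℤ)).prod volume

/-- The covering map `ℝ^n → Ω`, reducing the first `d` coordinates modulo `2π`. -/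
def proj (d k : ℕ) (x : Eucl (d + k)) : Omega d k :=
  (fun i => ((x (Fin.castAdd k i) : ℝ) : AddCircle (2 * Real.pi)),
    WithLp.toLp 2 fun j => x (Fin.natAdd d j))

/-- The inclusion `Ω^* ⊂ ℝ^n`. -/
def dualIncl {d k : ℕ} (ξ : OmegaDual d k) : Eucl (d + k) :=
  WithLp.toLp 2 (Fin.append (fun i => (ξ.1 i : ℝ)) fun j => ξ.2 j)

/-- The oscillating factor `e^{i z · ξ}` for `z ∈ Ω`, `ξ ∈ Ω^*`. -/
def character {d k : ℕ} (z : Omega d k) (ξ : OmegaDual d k) : ℂ :=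
  (∏ i, fourier (ξ.1 i) (z.1 i)) * Complex.exp (Complex.I * ((inner ℝ z.2 ξ.2 : ℝ) : ℂ))

/-- The directional derivative `∂_v f`. -/
def dirDeriv {E : Type} [NormedAddCommGroup E] [NormedSpace ℝ E] (v : E) (f : E → ℂ) : E → ℂ :=
  fun p => fderiv ℝ f p v

/-- `∂_{v_1}^{α_1} ⋯ ∂_{v_n}^{α_n} f` for a multi-index `α`. -/
def multiDeriv {E : Type} [NormedAddCommGroup E] [NormedSpace ℝ E] {n : ℕ}
    (v : Fin n → E) (α : Fin n → ℕ) (f : E → ℂ) : E → ℂ :=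
  (List.finRange n).foldr (fun i g => (dirDeriv (v i))^[α i] g) f

/-- The `i`-th standard basis vector of `ℝ^n`. -/
def stdVec {n : ℕ} (i : Fin n) : Eucl n := EuclideanSpace.single i (1 : ℝ)

/-- The order `|α|` of a multi-index. -/
def order {n : ℕ} (α : Fin n → ℕ) : ℕ := ∑ i, α i

/-- The partial derivative `∂^α f` of a function on `ℝ^n`. -/
def partialDeriv {n : ℕ} (α : Fin n → ℕ) (f : Eucl n → ℂ) : Eucl n → ℂ :=
  multiDeriv stdVec α f

/-- The mixed partial derivative `∂_x^α ∂_y^β ∂_ξ^γ b` of a function on `ℝ^n × ℝ^n × ℝ^n`. -/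
def mixedDeriv {n : ℕ} (α β γ : Fin n → ℕ) (b : Eucl n × Eucl n × Eucl n → ℂ) :
    Eucl n × Eucl n × Eucl n → ℂ :=
  multiDeriv (fun i => (stdVec i, 0, 0)) α
    (multiDeriv (fun i => (0, stdVec i, 0)) β
      (multiDeriv (fun i => (0, 0, stdVec i)) γ b))

/-- The pull-back of an amplitude on `Ω × Ω × ℝ^n` to `ℝ^n × ℝ^n × ℝ^n`. As `proj` is a covering
map and local diffeomorphism, smoothness and derivatives in `x`, `y` are those of the pull-back. -/
def liftAmp {d k : ℕ} (a : Omega d k → Omega d k → Eucl (d + k) → ℂ) :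
    Eucl (d + k) × Eucl (d + k) × Eucl (d + k) → ℂ :=
  fun p => a (proj d k p.1) (proj d k p.2.1) p.2.2

/-- The amplitude class `S^m(Ω) = S^m_{1,0,0}(Ω)`: smooth functions on `Ω × Ω × ℝ^n` with
`sup (1+|ξ|)^{|γ|-m} |∂_x^α ∂_y^β ∂_ξ^γ a| < ∞` for all `|α|, |β|, |γ| ≤ n + 1`. -/
structure IsAmplitude {d k : ℕ} (m : ℝ) (a : Omega d k → Omega d k → Eucl (d + k) → ℂ) :
    Prop where
  smooth : ContDiff ℝ ∞ (liftAmp a)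
  bound : ∀ α β γ : Fin (d + k) → ℕ,
    order α ≤ d + k + 1 → order β ≤ d + k + 1 → order γ ≤ d + k + 1 →
      ∃ C : ℝ, ∀ x y ξ : Eucl (d + k),
        (1 + ‖ξ‖) ^ ((order γ : ℝ) - m) * ‖mixedDeriv α β γ (liftAmp a) (x, y, ξ)‖ ≤ C

/-- The Schwartz class `𝓢(Ω)`: smooth functions all of whose derivatives decay rapidly in the
unbounded directions. -/
structure IsSchwartz {d k : ℕ} (u : Omega d k → ℂ) : Prop where
  smooth : ContDiff ℝ ∞ fun x => u (proj d k x)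
  decay : ∀ (α : Fin (d + k) → ℕ) (N : ℕ), ∃ C : ℝ, ∀ x : Eucl (d + k),
    (1 + ‖(proj d k x).2‖) ^ N * ‖partialDeriv α (fun z => u (proj d k z)) x‖ ≤ C

/-- The integrand `a(x,y,ξ) e^{i(x-y)·ξ} u(y)`, for `ξ ∈ Ω^*`. -/
def integrand {d k : ℕ} (a : Omega d k → Omega d k → Eucl (d + k) → ℂ) (u : Omega d k → ℂ)
    (x : Omega d k) (ξ : OmegaDual d k) (y : Omega d k) : ℂ :=
  a x y (dualIncl ξ) * character (x - y) ξ * u y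

/-- The pseudo-differential operator with amplitude `a`,
`Au(x) = ∫_{Ω^*} ∫_Ω a(x,y,ξ) e^{i(x-y)·ξ} u(y) dy dξ`, as an iterated integral. -/
def pdo {d k : ℕ} (a : Omega d k → Omega d k → Eucl (d + k) → ℂ) (u : Omega d k → ℂ) :
    Omega d k → ℂ :=
  fun x => ∫ ξ, (∫ y, integrand a u x ξ y ∂omegaMeasure d k) ∂dualMeasure d k

/-- The iterated integral defining `pdo a u x` converges (absolutely at each stage). -/
def PdoConverges {d k : ℕ} (a : Omega d k → Omega d k → Eucl (d + k) → ℂ) (u : Omega d k → ℂ)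
    (x : Omega d k) : Prop :=
  (∀ ξ, Integrable (integrand a u x ξ) (omegaMeasure d k)) ∧
    Integrable (fun ξ => ∫ y, integrand a u x ξ y ∂omegaMeasure d k) (dualMeasure d k)

/-- `sup_{ξ ∈ ℝ^n, |α| ≤ n+1} (1+|ξ|)^{|α|+m} |∂_ξ^α a(x,y,ξ)|`, as a number in `[0,∞]`. -/
def decaySup {d k : ℕ} (m : ℝ) (a : Omega d k → Omega d k → Eucl (d + k) → ℂ)
    (x y : Omega d k) : ℝ≥0∞ :=
  ⨆ (ξ : Eucl (d + k)) (α : Fin (d + k) → ℕ) (_ : order α ≤ d + k + 1),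
    ENNReal.ofReal ((1 + ‖ξ‖) ^ ((order α : ℝ) + m) * ‖partialDeriv α (a x y) ξ‖)

/-- The filter `x, y → ∞, |x - y| < R` on `Ω × Ω`. The distance is the product (maximum) distance;
as all `R` are considered, any other product distance gives the same condition. -/
def nearDiagInfty (d k : ℕ) (R : ℝ) : Filter (Omega d k × Omega d k) :=
  (cocompact (Omega d k) ×ˢ cocompact (Omega d k)) ⊓ 𝓟 {p | dist p.1 p.2 < R}

/-- The Hilbert space `L²(Ω)` of complex-valued functions. -/
abbrev L2 (d k : ℕ) : Type := Lp ℂ 2 (omegaMeasure d k)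

/-- `T` is the bounded operator on `L²(Ω)` extending the operator with amplitude `a`, which is
given on the (dense) Schwartz class by the convergent iterated integral `pdo`. -/
def IsL2Extension {d k : ℕ} (a : Omega d k → Omega d k → Eucl (d + k) → ℂ)
    (T : L2 d k →L[ℂ] L2 d k) : Prop :=
  ∀ u : Omega d k → ℂ, IsSchwartz u →
    (∀ x, PdoConverges a u x) ∧
      ∃ hu : MemLp u 2 (omegaMeasure d k), T (hu.toLp u) =ᵐ[omegaMeasure d k] pdo a u

end MixedPDO

end

/-!
# Compactness of pseudo-differential operators of negative order on `𝕋^d × ℝ^k`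

Write `n = d + k`. For negative order no almost-orthogonality is needed: the operator is a norm
convergent series of dyadic pieces, each controlled by the Schur test.

Cut the amplitude off smoothly at frequency `2^J` (`cutoff`). The cut-off operator has the
continuous kernel `K_J(x, y) = ∫ a(x, y, ξ) χ(2^{-J} ξ) e^{i(x-y)·ξ} dξ` (`cutoffKernel`). A symbol
of size `B` supported at frequency `ρ` has a kernel bounded by `C B ρ^n (1 + ρ |x - y|)^{-(n+1)}`
(`exists_norm_integral_character_le`). The proof uses finite differences in `ξ` in place of
derivatives: a translation of `Ω^*` multiplies `e^{iz·ξ}` by a constant `e^{iθ}`, and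
`|e^{iθ} - 1| ≥ 2|θ|/π` for `|θ| ≤ π` (`mul_norm_integral_mul_le`). This treats the discrete and the
continuous frequencies alike; with step `1` in a discrete frequency the phase is the angle in
`[-π, π]` of the periodic variable, whose modulus is the norm on the circle.

As balls of radius `r` in `Ω` have measure `O(r^n)`, such a kernel has Schur norm `O(B)`. The
difference `K_{J+1} - K_J` lives at frequency `2^J`, where `B` is of the order of `2^{Jm}`
(`IsAmplitude.exists_schurBound_sub`). So the cut-off operators form a Cauchy sequence in operator
norm, and the limit is compact once each of them is.

For fixed `J` the kernel is dominated by an integrable function of `x - y`, so its part away from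
the diagonal has small Schur norm. Near the diagonal it tends to zero at infinity: only boundedly
many frequencies are involved, and there the hypothesis says that `a` itself tends to zero uniformly
(`IsAmplitude.cutoffKernel_near_diagonal`). Hence, off a compact square, the kernel has small Schur
norm (`exists_schurBound_off_compact`); on the square it is uniformly continuous and is approximated
by kernels of finite rank (`isCompactOperator_of_tight`).

For a Schwartz function `u` the same difference argument, now in `y`, shows that the inner integral
is `O((1 + |ξ|)^{-(n+1)})` (`exists_norm_integral_integrand_le`), which is integrable over `Ω^*`. By
Fubini and dominated convergence the cut-off operators applied to `u` converge pointwise to the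
iterated integral, which is therefore the value of the limit operator.
-/

noncomputable section

namespace MixedPDO

/-! ### Directional derivatives and finite differences -/

section Calculus

variable {E : Type} [NormedAddCommGroup E] [NormedSpace ℝ E]

theorem contDiff_dirDeriv {F : E → ℂ} (hF : ContDiff ℝ ∞ F) (v : E) :
    ContDiff ℝ ∞ (dirDeriv v F) :=
  (hF.fderiv_right (m := ∞) (by simp)).clm_apply contDiff_const

theorem contDiff_dirDeriv_iterate {F : E → ℂ} (hF : ContDiff ℝ ∞ F) (v : E) (l : ℕ) :
    ContDiff ℝ ∞ ((dirDeriv v)^[l] F) := by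
  induction l with
  | zero => exact hF
  | succ l ih =>
    rw [Function.iterate_succ_apply']
    exact contDiff_dirDeriv ih v

/-- Iterated directional derivatives are iterated derivatives along lines. -/
theorem iteratedDeriv_comp_line {F : E → ℂ} (hF : ContDiff ℝ ∞ F) (p v : E) (l : ℕ) :
    iteratedDeriv l (fun t : ℝ => F (p + t • v)) =
      fun t => ((dirDeriv v)^[l] F) (p + t • v) := by
  induction l with
  | zero => rfl
  | succ l ih =>
    rw [iteratedDeriv_succ, ih]
    funext t
    have h1 : HasDerivAt (fun t : ℝ => p + t • v) v t := by
      simpa using ((hasDerivAt_id t).smul_const v).const_add p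
    have h2 := ((contDiff_dirDeriv_iterate hF v l).differentiable (by simp)
      (p + t • v)).hasFDerivAt
    rw [Function.iterate_succ_apply']
    exact (h2.comp_hasDerivAt t h1).deriv

/-- Chain rule for a map that sends lines in direction `w` to lines in direction `v`. -/
theorem dirDeriv_iterate_comp {E' : Type} [NormedAddCommGroup E'] [NormedSpace ℝ E']
    {F : E → ℂ} (hF : ContDiff ℝ ∞ F) {φ : E' → E} (hφ : ContDiff ℝ ∞ φ) {v : E} {w : E'}
    (h : ∀ q (t : ℝ), φ (q + t • w) = φ q + t • v) (l : ℕ) (q : E') :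
    ((dirDeriv w)^[l] fun x => F (φ x)) q = ((dirDeriv v)^[l] F) (φ q) := by
  have h1 := congrFun (iteratedDeriv_comp_line (hF.comp hφ) q w l) 0
  have h2 := congrFun (iteratedDeriv_comp_line hF (φ q) v l) 0
  simp only [Function.comp_def, h, zero_smul, add_zero] at h1 h2
  exact h1.symm.trans h2

theorem dirDeriv_iterate_comp_smul {F : E → ℂ} (hF : ContDiff ℝ ∞ F) (c : ℝ) (v : E) (l : ℕ)
    (q : E) :
    ((dirDeriv v)^[l] fun x => F (c • x)) q = (c : ℂ) ^ l * ((dirDeriv v)^[l] F) (c • q) := by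
  have hG : ContDiff ℝ ∞ fun x => F (c • x) := hF.comp (contDiff_const_smul c)
  have h1 := congrFun (iteratedDeriv_comp_line hG q v l) 0
  have h2 := congrFun (iteratedDeriv_comp_line hF (c • q) v l) 0
  have h3 : ContDiff ℝ ∞ fun t : ℝ => F (c • q + t • v) := hF.comp (by fun_prop)
  have h4 := congrFun
    (iteratedDeriv_comp_const_smul (n := l) (h3.of_le (by exact_mod_cast le_top)) c) 0
  simp only [smul_add, smul_smul, zero_smul, add_zero, mul_zero] at h1 h2 h4
  rw [← h1, h4, h2, Complex.real_smul, Complex.ofReal_pow]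

theorem multiDeriv_single {n : ℕ} (v : Fin n → E) (i : Fin n) (l : ℕ) (F : E → ℂ) :
    multiDeriv v (Pi.single i l) F = (dirDeriv (v i))^[l] F := by
  have key : ∀ L : List (Fin n), L.Nodup →
      L.foldr (fun j g => (dirDeriv (v j))^[(Pi.single i l : Fin n → ℕ) j] g) F =
        if i ∈ L then (dirDeriv (v i))^[l] F else F := by
    intro L
    induction L with
    | nil => simp
    | cons j L ih =>
      intro hL
      rw [List.nodup_cons] at hL
      rw [List.foldr_cons, ih hL.2]
      by_cases hj : j = i
      · subst hj
        simp [hL.1]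
      · simp [Ne.symm hj]
  rw [multiDeriv, key _ (List.nodup_finRange n)]
  simp

theorem multiDeriv_zero {n : ℕ} (v : Fin n → E) (F : E → ℂ) : multiDeriv v 0 F = F := by
  unfold multiDeriv
  induction List.finRange n with
  | nil => rfl
  | cons j L ih => rw [List.foldr_cons, ih]; rfl

theorem order_single {n : ℕ} (i : Fin n) (l : ℕ) : order (Pi.single i l : Fin n → ℕ) = l := by
  simp [order]

theorem order_zero {n : ℕ} : order (0 : Fin n → ℕ) = 0 := by simp [order]

theorem norm_dirDeriv_iterate_mul_le {F G : E → ℂ} (hF : ContDiff ℝ ∞ F) (hG : ContDiff ℝ ∞ G)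
    (v p : E) (l : ℕ) :
    ‖((dirDeriv v)^[l] fun x => F x * G x) p‖ ≤ ∑ i ∈ Finset.range (l + 1),
      (l.choose i : ℝ) * ‖((dirDeriv v)^[i] F) p‖ * ‖((dirDeriv v)^[l - i] G) p‖ := by
  have line : ∀ {H : E → ℂ}, ContDiff ℝ ∞ H → ContDiff ℝ ∞ fun t : ℝ => H (p + t • v) :=
    fun h => h.comp (by fun_prop)
  have key : ∀ {H : E → ℂ}, ContDiff ℝ ∞ H → ∀ l,
      ‖iteratedFDeriv ℝ l (fun t : ℝ => H (p + t • v)) 0‖ = ‖((dirDeriv v)^[l] H) p‖ := by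
    intro H hH l
    rw [norm_iteratedFDeriv_eq_norm_iteratedDeriv, iteratedDeriv_comp_line hH]
    simp
  have := norm_iteratedFDeriv_mul_le (line hF) (line hG) (0 : ℝ) (n := l)
    (by exact_mod_cast le_top)
  simp only [key hF, key hG] at this
  rwa [key (H := fun x => F x * G x) (hF.mul hG)] at this

/-- A Leibniz bound at one point: if each derivative of the two factors costs at most a factor
`s`, the same is true of the product, up to the constant `2 ^ l`. -/
theorem norm_dirDeriv_iterate_mul_le_of_bounds {F G : E → ℂ} (hF : ContDiff ℝ ∞ F)
    (hG : ContDiff ℝ ∞ G) (v p : E) (l : ℕ) {A B s : ℝ}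
    (hA : ∀ i ≤ l, ‖((dirDeriv v)^[i] F) p‖ ≤ A * s ^ i)
    (hB : ∀ i ≤ l, ‖((dirDeriv v)^[i] G) p‖ ≤ B * s ^ i) :
    ‖((dirDeriv v)^[l] fun x => F x * G x) p‖ ≤ 2 ^ l * A * B * s ^ l := by
  refine (norm_dirDeriv_iterate_mul_le hF hG v p l).trans ?_
  have : (2 : ℝ) ^ l * A * B * s ^ l =
      ∑ i ∈ Finset.range (l + 1), (l.choose i : ℝ) * (A * s ^ i) * (B * s ^ (l - i)) := by
    have h2 : (2 : ℝ) ^ l = ∑ i ∈ Finset.range (l + 1), (l.choose i : ℝ) := by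
      exact_mod_cast (Nat.sum_range_choose l).symm
    rw [h2, Finset.sum_mul, Finset.sum_mul, Finset.sum_mul]
    refine Finset.sum_congr rfl fun i hi => ?_
    rw [← Nat.add_sub_of_le (Nat.lt_succ_iff.1 (Finset.mem_range.1 hi)), pow_add]
    simp only [add_tsub_cancel_left]
    ring
  rw [this]
  refine Finset.sum_le_sum fun i hi => ?_
  have hi' := Nat.lt_succ_iff.1 (Finset.mem_range.1 hi)
  exact mul_le_mul (mul_le_mul_of_nonneg_left (hA i hi') (by positivity)) (hB _ (Nat.sub_le l i))
    (norm_nonneg _) (mul_nonneg (by positivity) ((norm_nonneg _).trans (hA i hi')))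

end Calculus

section Differences

/-- The finite difference operator commutes with pull-back along a map that intertwines the two
translations. -/
theorem fwdDiff_iterate_comp {M M' : Type*} [AddCommMonoid M] [AddCommMonoid M']
    {φ : M → M'} {h : M} {h' : M'} (hφ : ∀ x, φ (x + h) = φ x + h') (F : M' → ℂ) (l : ℕ) :
    (fwdDiff h)^[l] (fun x => F (φ x)) = fun x => ((fwdDiff h')^[l] F) (φ x) := by
  induction l with
  | zero => rfl
  | succ l ih =>
    rw [Function.iterate_succ_apply', Function.iterate_succ_apply', ih]
    funext x
    simp only [fwdDiff, hφ]

theorem norm_fwdDiff_iterate_real_le {f : ℝ → ℂ} (hf : ContDiff ℝ ∞ f) {h B : ℝ} (hh : 0 ≤ h)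
    (l : ℕ) (s : ℝ) (hB : ∀ t ∈ Set.Icc s (s + l * h), ‖iteratedDeriv l f t‖ ≤ B) :
    ‖((fwdDiff h)^[l] f) s‖ ≤ h ^ l * B := by
  induction l generalizing f B with
  | zero => simpa using hB s (by simp)
  | succ l ih =>
    rw [Function.iterate_succ_apply]
    have hs : ContDiff ℝ ∞ fun t => f (t + h) := hf.comp (by fun_prop)
    have hd : ContDiff ℝ ∞ (fwdDiff h f) := hs.sub hf
    rw [pow_succ, mul_assoc]
    refine ih hd fun t ht => ?_
    have e1 : iteratedDeriv l (fwdDiff h f) t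
        = iteratedDeriv l f (t + h) - iteratedDeriv l f t := by
      have : fwdDiff h f = (fun t => f (t + h)) - f := rfl
      rw [this, iteratedDeriv_sub (hs.contDiffAt.of_le (by exact_mod_cast le_top))
        (hf.contDiffAt.of_le (by exact_mod_cast le_top)), iteratedDeriv_comp_add_const]
    rw [e1]
    have hdiff : Differentiable ℝ (iteratedDeriv l f) :=
      hf.differentiable_iteratedDeriv l (by exact_mod_cast WithTop.coe_lt_top _)
    have := norm_image_sub_le_of_norm_deriv_le_segment' (f := iteratedDeriv l f) (a := t)
      (b := t + h) (C := B) (fun x _ => (hdiff x).hasDerivAt.hasDerivWithinAt) (fun x hx => by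
        rw [← iteratedDeriv_succ]
        refine hB x ⟨ht.1.trans hx.1, ?_⟩
        have := ht.2
        push_cast
        linarith [hx.2]) (t + h) ⟨by linarith, le_rfl⟩
    rwa [add_sub_cancel_left, mul_comm] at this

/-- The `l`-th difference of step `h` in direction `v` is at most `h ^ l` times the supremum of
`∂_v^l F` over the segment it samples. -/
theorem norm_fwdDiff_iterate_le {E : Type} [NormedAddCommGroup E] [NormedSpace ℝ E] {F : E → ℂ}
    (hF : ContDiff ℝ ∞ F) (p v : E) {h B : ℝ} (hh : 0 ≤ h) (l : ℕ)
    (hB : ∀ t ∈ Set.Icc (0 : ℝ) (l * h), ‖((dirDeriv v)^[l] F) (p + t • v)‖ ≤ B) :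
    ‖((fwdDiff (h • v))^[l] F) p‖ ≤ h ^ l * B := by
  have hline : ContDiff ℝ ∞ fun t : ℝ => F (p + t • v) := hF.comp (by fun_prop)
  have h1 := fwdDiff_iterate_comp (φ := fun t : ℝ => p + t • v) (h := h) (h' := h • v)
    (fun x => by rw [add_smul, add_assoc]) F l
  have h2 := norm_fwdDiff_iterate_real_le hline hh l 0 (B := B) (by
    rw [iteratedDeriv_comp_line hF]
    simpa using hB)
  rw [h1] at h2
  simpa using h2

variable {G : Type*} [AddCommGroup G] [MeasurableSpace G] [MeasurableAdd G]

theorem integrable_fwdDiff_iterate {μ : Measure G} [μ.IsAddRightInvariant] {f : G → ℂ}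
    (hf : Integrable f μ) (v : G) (l : ℕ) : Integrable ((fwdDiff v)^[l] f) μ := by
  induction l with
  | zero => exact hf
  | succ l ih =>
    rw [Function.iterate_succ_apply']
    exact (ih.comp_add_right v).sub ih

/-- Summation by parts against a unitary character `e` of an abelian group. -/
theorem integral_fwdDiff_iterate_mul {μ : Measure G} [μ.IsAddRightInvariant] {f e : G → ℂ}
    (hf : Integrable f μ) (hem : Measurable e) (he : ∀ x y, e (x + y) = e x * e y)
    (he1 : ∀ x, ‖e x‖ = 1) (v : G) (l : ℕ) :
    ∫ x, ((fwdDiff v)^[l] f) x * e x ∂μ = (e (-v) - 1) ^ l * ∫ x, f x * e x ∂μ := by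
  have hint : ∀ {g : G → ℂ}, Integrable g μ → Integrable (fun x => g x * e x) μ := fun hg =>
    hg.mul_bdd (c := 1) hem.aestronglyMeasurable (ae_of_all _ fun x => (he1 x).le)
  induction l with
  | zero => simp
  | succ l ih =>
    have hg := integrable_fwdDiff_iterate hf v l
    set g := (fwdDiff v)^[l] f
    have hev : e v * e (-v) = 1 := by
      have h0 : e 0 = 1 := by
        have h := he 0 0
        rw [add_zero] at h
        have hne : e 0 ≠ 0 := norm_ne_zero_iff.1 (by rw [he1]; exact one_ne_zero)
        exact (mul_right_cancel₀ hne (by rw [one_mul]; exact h)).symm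
      rw [← he, add_neg_cancel, h0]
    rw [Function.iterate_succ_apply', pow_succ', mul_assoc, ← ih]
    have h1 : ∫ x, g (x + v) * e x ∂μ = e (-v) * ∫ x, g x * e x ∂μ := by
      rw [← integral_add_right_eq_self (fun x => g x * e x) v, ← integral_const_mul]
      refine integral_congr_ae (ae_of_all _ fun x => ?_)
      simp only [he]
      linear_combination (-(g (x + v) * e x)) * hev
    have h2 : ∫ x, fwdDiff v g x * e x ∂μ =
        ∫ x, (g (x + v) * e x - g x * e x) ∂μ :=
      integral_congr_ae (ae_of_all _ fun x => by simp only [fwdDiff]; ring)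
    rw [h2, integral_sub (hint (hg.comp_add_right v)) (hint hg), h1]
    ring

/-- Jordan's inequality for the chord `|e^{iθ} - 1|`. -/
theorem two_div_pi_mul_abs_le {θ : ℝ} (hθ : |θ| ≤ Real.pi) :
    2 / Real.pi * |θ| ≤ ‖Complex.exp (Complex.I * θ) - 1‖ := by
  rw [Complex.norm_exp_I_mul_ofReal_sub_one, Real.norm_eq_abs, abs_mul, abs_two]
  have := Real.mul_abs_le_abs_sin (x := θ / 2) (by rw [abs_div, abs_two]; linarith)
  rw [abs_div, abs_two] at this
  linarith

/-- The oscillatory integral of `f` against a unitary character, with a gain `|θ|^l` from `l`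
differences in a direction in which the character turns by the angle `θ`. -/
theorem mul_norm_integral_mul_le {μ : Measure G} [μ.IsAddRightInvariant] {f e : G → ℂ}
    (hf : Integrable f μ) (hem : Measurable e) (he : ∀ x y, e (x + y) = e x * e y)
    (he1 : ∀ x, ‖e x‖ = 1) {v : G} {θ : ℝ} (hθ : |θ| ≤ Real.pi)
    (hv : e (-v) = Complex.exp (Complex.I * θ)) (l : ℕ) :
    (2 / Real.pi * |θ|) ^ l * ‖∫ x, f x * e x ∂μ‖ ≤ ∫ x, ‖((fwdDiff v)^[l] f) x‖ ∂μ := by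
  have h := integral_fwdDiff_iterate_mul hf hem he he1 v l
  have h2 : (2 / Real.pi * |θ|) ^ l ≤ ‖(e (-v) - 1) ^ l‖ := by
    rw [norm_pow, hv]
    exact pow_le_pow_left₀ (by positivity) (two_div_pi_mul_abs_le hθ) l
  calc _ ≤ ‖(e (-v) - 1) ^ l‖ * ‖∫ x, f x * e x ∂μ‖ := by gcongr
    _ = ‖∫ x, ((fwdDiff v)^[l] f) x * e x ∂μ‖ := by rw [h, norm_mul]
    _ ≤ ∫ x, ‖((fwdDiff v)^[l] f) x * e x‖ ∂μ := norm_integral_le_integral_norm _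
    _ = _ := by simp only [norm_mul, he1, mul_one]

end Differences

/-! ### Volume growth -/

/-- If the sublevel sets `{r ≤ 2^l}` have measure at most `A 2^{ln}`, then `(1 + r)^{-(n+1)}` has
integral at most `2^{n+2} A`: sum over the dyadic shells of `r`. -/
theorem lintegral_inv_one_add_pow_le {X : Type*} [MeasurableSpace X] {μ : Measure X} {r : X → ℝ}
    (hr : Measurable r) (hr0 : ∀ x, 0 ≤ r x) {A : ℝ≥0∞} {n : ℕ}
    (hA : ∀ l : ℕ, μ {x | r x ≤ 2 ^ l} ≤ A * 2 ^ (l * n)) :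
    ∫⁻ x, ENNReal.ofReal ((1 + r x) ^ (n + 1))⁻¹ ∂μ ≤ 2 ^ (n + 2) * A := by
  set S : ℕ → Set X := fun l => {x | r x ≤ 2 ^ l} with hS
  have hSm : ∀ l, MeasurableSet (S l) := fun l => measurableSet_le hr measurable_const
  have hpt : ∀ x, ENNReal.ofReal ((1 + r x) ^ (n + 1))⁻¹ ≤
      ∑' l : ℕ, (S l).indicator (fun _ => (2 : ℝ≥0∞) ^ (n + 1) * (2⁻¹) ^ (l * (n + 1))) x := by
    intro x
    have hex : ∃ l : ℕ, r x ≤ 2 ^ l := by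
      obtain ⟨l, hl⟩ := pow_unbounded_of_one_lt (r x) (one_lt_two)
      exact ⟨l, hl.le⟩
    classical
    set l := Nat.find hex with hl
    refine le_trans ?_ (ENNReal.le_tsum l)
    rw [Set.indicator_of_mem (show x ∈ S l from Nat.find_spec hex)]
    have hlow : (2 : ℝ) ^ l ≤ 2 * (1 + r x) := by
      rcases Nat.eq_zero_or_pos l with h0 | h0
      · rw [h0]; have := hr0 x; norm_num; linarith
      · obtain ⟨l', h'⟩ := Nat.exists_eq_succ_of_ne_zero h0.ne'
        have : ¬ r x ≤ 2 ^ l' := Nat.find_min hex (by omega)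
        rw [h', Nat.succ_eq_add_one, pow_succ]
        linarith
    have h1 : ((1 + r x) ^ (n + 1))⁻¹ ≤ 2 ^ (n + 1) * ((2 : ℝ)⁻¹) ^ (l * (n + 1)) := by
      have hpos : 0 < 1 + r x := by linarith [hr0 x]
      rw [pow_mul, ← mul_pow, ← inv_pow]
      refine pow_le_pow_left₀ (by positivity) ?_ _
      rw [inv_pow, ← div_eq_mul_inv, inv_le_comm₀ hpos (by positivity), inv_div,
        div_le_iff₀ two_pos]
      linarith
    refine (ENNReal.ofReal_le_ofReal h1).trans (le_of_eq ?_)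
    rw [ENNReal.ofReal_mul (by positivity), ENNReal.ofReal_pow (by positivity),
      ENNReal.ofReal_pow (by positivity), ENNReal.ofReal_inv_of_pos two_pos]
    simp
  calc _ ≤ ∫⁻ x, ∑' l : ℕ,
        (S l).indicator (fun _ => (2 : ℝ≥0∞) ^ (n + 1) * (2⁻¹) ^ (l * (n + 1))) x ∂μ :=
        lintegral_mono hpt
    _ = ∑' l : ℕ, 2 ^ (n + 1) * (2⁻¹) ^ (l * (n + 1)) * μ (S l) := by
        rw [lintegral_tsum fun l => (measurable_const.indicator (hSm l)).aemeasurable]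
        simp only [lintegral_indicator_const (hSm _)]
    _ ≤ ∑' l : ℕ, 2 ^ (n + 1) * A * (2⁻¹) ^ l := by
        refine ENNReal.tsum_le_tsum fun l => ?_
        calc _ ≤ 2 ^ (n + 1) * (2⁻¹) ^ (l * (n + 1)) * (A * 2 ^ (l * n)) := by
              gcongr; exact hA l
          _ = 2 ^ (n + 1) * A * (2⁻¹) ^ l * ((2⁻¹) ^ (l * n) * 2 ^ (l * n)) := by
              rw [mul_add, mul_one, pow_add]; ring
          _ = _ := by
              rw [← mul_pow, ENNReal.inv_mul_cancel two_ne_zero (by norm_num), one_pow, mul_one]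
    _ = 2 ^ (n + 2) * A := by
        rw [ENNReal.tsum_mul_left, ENNReal.tsum_geometric, ENNReal.one_sub_inv_two, inv_inv]
        ring

section Domain

variable {d k : ℕ}

theorem haarAddCircle_closedBall_le (r : ℝ) :
    (AddCircle.haarAddCircle : Measure (AddCircle (2 * Real.pi))) (Metric.closedBall 0 r) ≤
      ENNReal.ofReal (2 * r) := by
  have h := AddCircle.volume_closedBall (2 * Real.pi) (x := 0) r
  rw [AddCircle.volume_eq_smul_haarAddCircle, Measure.smul_apply, smul_eq_mul] at h
  have h1 : (1 : ℝ≥0∞) ≤ ENNReal.ofReal (2 * Real.pi) := by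
    rw [← ENNReal.ofReal_one]
    exact ENNReal.ofReal_le_ofReal (by linarith [Real.pi_gt_three])
  calc _ ≤ ENNReal.ofReal (2 * Real.pi) * AddCircle.haarAddCircle (Metric.closedBall 0 r) :=
        le_mul_of_one_le_left' h1
    _ ≤ _ := by
        rw [h]
        exact ENNReal.ofReal_le_ofReal (min_le_right _ _)

theorem exists_omegaMeasure_closedBall_le (d k : ℕ) : ∃ A : NNReal, ∀ r : ℝ, 0 ≤ r →
    omegaMeasure d k (Metric.closedBall 0 r) ≤ A * ENNReal.ofReal r ^ (d + k) := by
  set V := (volume : Measure (EuclideanSpace ℝ (Fin k))) (Metric.ball 0 1) with hV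
  have hVt : V ≠ ⊤ := measure_ball_lt_top.ne
  refine ⟨2 ^ d * V.toNNReal, fun r hr => ?_⟩
  have h0 : Metric.closedBall (0 : Omega d k) r =
      (Set.univ.pi fun _ => Metric.closedBall 0 r) ×ˢ Metric.closedBall 0 r := by
    rw [← closedBall_pi _ hr, closedBall_prod_same]
    rfl
  rw [h0, Measure.prod_prod, Measure.pi_pi, Finset.prod_const, Finset.card_univ, Fintype.card_fin,
    Measure.addHaar_closedBall (volume : Measure (EuclideanSpace ℝ (Fin k))) _ hr,
    finrank_euclideanSpace_fin, pow_add]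
  push_cast
  rw [ENNReal.coe_toNNReal hVt]
  calc _ ≤ (2 * ENNReal.ofReal r) ^ d * (ENNReal.ofReal (r ^ k) * V) := by
        gcongr
        refine (haarAddCircle_closedBall_le r).trans ?_
        rw [ENNReal.ofReal_mul two_pos.le]; simp
    _ = _ := by
        rw [mul_pow, ENNReal.ofReal_pow hr]; ring

theorem dualIncl_castAdd (ξ : OmegaDual d k) (i : Fin d) :
    dualIncl ξ (Fin.castAdd k i) = ξ.1 i := by
  simp [dualIncl]

theorem dualIncl_natAdd (ξ : OmegaDual d k) (j : Fin k) :
    dualIncl ξ (Fin.natAdd d j) = ξ.2 j := by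
  simp [dualIncl]

theorem eucl_ext {x y : Eucl (d + k)} (h1 : ∀ i, x (Fin.castAdd k i) = y (Fin.castAdd k i))
    (h2 : ∀ j, x (Fin.natAdd d j) = y (Fin.natAdd d j)) : x = y := by
  ext i
  exact Fin.addCases h1 h2 i

theorem dualIncl_add (ξ η : OmegaDual d k) : dualIncl (ξ + η) = dualIncl ξ + dualIncl η := by
  apply eucl_ext <;> intro i <;>
    simp [dualIncl_castAdd, dualIncl_natAdd]

theorem continuous_dualIncl : Continuous (dualIncl : OmegaDual d k → Eucl (d + k)) := by
  refine (PiLp.continuous_toLp 2 _).comp (continuous_pi fun i => ?_)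
  refine Fin.addCases (fun i => ?_) (fun j => ?_) i
  · simp only [Fin.append_left]
    exact continuous_of_discreteTopology.comp ((continuous_apply i).comp continuous_fst)
  · simp only [Fin.append_right]
    fun_prop

theorem abs_apply_le_norm_dualIncl (ξ : OmegaDual d k) (i : Fin d) :
    |(ξ.1 i : ℝ)| ≤ ‖dualIncl ξ‖ := by
  rw [← dualIncl_castAdd ξ i]
  exact PiLp.norm_apply_le (dualIncl ξ) (Fin.castAdd k i)

theorem norm_snd_le_norm_dualIncl (ξ : OmegaDual d k) : ‖ξ.2‖ ≤ ‖dualIncl ξ‖ := by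
  rw [EuclideanSpace.norm_eq, EuclideanSpace.norm_eq]
  refine Real.sqrt_le_sqrt ?_
  rw [Fin.sum_univ_add]
  simp only [dualIncl_natAdd]
  exact le_add_of_nonneg_left (Finset.sum_nonneg fun _ _ => sq_nonneg _)

theorem exists_dualMeasure_le (d k : ℕ) : ∃ A : NNReal, ∀ r : ℝ, 1 ≤ r →
    dualMeasure d k {ξ | ‖dualIncl ξ‖ ≤ r} ≤ A * ENNReal.ofReal r ^ (d + k) := by
  set V := (volume : Measure (EuclideanSpace ℝ (Fin k))) (Metric.ball 0 1) with hV
  have hVt : V ≠ ⊤ := measure_ball_lt_top.ne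
  refine ⟨3 ^ d * V.toNNReal, fun r hr => ?_⟩
  set F : Finset (Fin d → ℤ) := Fintype.piFinset fun _ => Finset.Icc (-⌊r⌋) ⌊r⌋ with hF
  have hsub : {ξ : OmegaDual d k | ‖dualIncl ξ‖ ≤ r} ⊆ (F : Set (Fin d → ℤ)) ×ˢ
      Metric.closedBall 0 r := by
    intro ξ hξ
    refine ⟨?_, ?_⟩
    · simp only [hF, Finset.mem_coe, Fintype.mem_piFinset, Finset.mem_Icc]
      intro i
      have := abs_le.1 ((abs_apply_le_norm_dualIncl ξ i).trans hξ)
      exact ⟨by have h : -ξ.1 i ≤ ⌊r⌋ := Int.le_floor.2 (by push_cast; linarith)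
                linarith, Int.le_floor.2 this.2⟩
    · simpa using (norm_snd_le_norm_dualIncl ξ).trans hξ
  refine (measure_mono hsub).trans ?_
  rw [Measure.prod_prod, Measure.count_apply_finset, hF, Fintype.card_piFinset_const,
    Measure.addHaar_closedBall _ _ (by linarith), finrank_euclideanSpace_fin, pow_add]
  push_cast
  rw [ENNReal.coe_toNNReal hVt, Int.card_Icc]
  have hcard : (((⌊r⌋ + 1 - -⌊r⌋).toNat : ℕ) : ℝ≥0∞) ≤ 3 * ENNReal.ofReal r := by
    have hfl : (⌊r⌋ : ℝ) ≤ r := Int.floor_le r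
    have h1 : 1 ≤ ⌊r⌋ := Int.le_floor.2 (by simpa using hr)
    have h2 : (((⌊r⌋ + 1 - -⌊r⌋).toNat : ℕ) : ℝ) ≤ 3 * r := by
      have : (((⌊r⌋ + 1 - -⌊r⌋).toNat : ℤ) : ℝ) = ((⌊r⌋ + 1 - -⌊r⌋ : ℤ) : ℝ) := by
        rw [Int.toNat_of_nonneg (by omega)]
      rw [Int.cast_natCast] at this
      rw [this]
      push_cast
      linarith
    rw [← ENNReal.ofReal_natCast]
    refine (ENNReal.ofReal_le_ofReal h2).trans ?_
    rw [ENNReal.ofReal_mul (by norm_num)]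
    simp
  calc _ ≤ (3 * ENNReal.ofReal r) ^ d * (ENNReal.ofReal (r ^ k) * V) := by gcongr
    _ = _ := by
        rw [mul_pow, ENNReal.ofReal_pow (by linarith)]; ring

/-- `(1 + |ξ|)^{-(n+1)}` is integrable over `Ω^*`. -/
theorem integrable_inv_one_add_dual (d k : ℕ) :
    Integrable (fun ξ : OmegaDual d k => ((1 + ‖dualIncl ξ‖) ^ (d + k + 1))⁻¹)
      (dualMeasure d k) := by
  obtain ⟨A, hA⟩ := exists_dualMeasure_le d k
  have hm : Measurable fun ξ : OmegaDual d k => ‖dualIncl ξ‖ := continuous_dualIncl.norm.measurable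
  have h := lintegral_inv_one_add_pow_le (μ := dualMeasure d k) hm (fun _ => norm_nonneg _)
    (A := A) (n := d + k) fun l => by
      refine (hA (2 ^ l) (one_le_pow₀ one_le_two)).trans (le_of_eq ?_)
      rw [ENNReal.ofReal_pow two_pos.le, ← pow_mul]
      simp
  refine ⟨((hm.const_add 1).pow_const _).inv.aestronglyMeasurable, ?_⟩
  rw [hasFiniteIntegral_iff_ofReal (ae_of_all _ fun _ => by positivity)]
  exact h.trans_lt (ENNReal.mul_lt_top (by simp) (by simp))

/-- The scaled integral over `Ω`: `∫ (1 + ρ|z|)^{-(n+1)} dz ≤ C ρ^{-n}`. -/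
theorem exists_lintegral_inv_one_add_scaled_le (d k : ℕ) : ∃ C : NNReal, ∀ ρ : ℝ, 0 < ρ →
    ∫⁻ z : Omega d k, ENNReal.ofReal ((1 + ρ * ‖z‖) ^ (d + k + 1))⁻¹ ∂omegaMeasure d k ≤
      C * ENNReal.ofReal (ρ⁻¹) ^ (d + k) := by
  obtain ⟨A, hA⟩ := exists_omegaMeasure_closedBall_le d k
  refine ⟨2 ^ (d + k + 2) * A, fun ρ hρ => ?_⟩
  have h := lintegral_inv_one_add_pow_le (μ := omegaMeasure d k) (r := fun z => ρ * ‖z‖)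
    (by fun_prop) (fun _ => by positivity)
    (A := A * ENNReal.ofReal (ρ⁻¹) ^ (d + k)) (n := d + k) fun l => by
      have : {z : Omega d k | ρ * ‖z‖ ≤ 2 ^ l} = Metric.closedBall 0 (2 ^ l * ρ⁻¹) := by
        ext z
        rw [Set.mem_ofPred_eq, mem_closedBall_zero_iff, ← div_eq_mul_inv, le_div_iff₀ hρ, mul_comm]
      rw [this]
      refine (hA _ (by positivity)).trans (le_of_eq ?_)
      rw [ENNReal.ofReal_mul (by positivity), ENNReal.ofReal_pow two_pos.le, mul_pow, ← pow_mul]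
      simp only [ENNReal.ofReal_ofNat]
      ring
  refine h.trans (le_of_eq ?_)
  push_cast
  ring

/-- Decay in the unbounded directions makes a function integrable over `Ω`. -/
theorem integrable_inv_one_add_snd (d k : ℕ) :
    Integrable (fun y : Omega d k => ((1 + ‖y.2‖) ^ (k + 1))⁻¹) (omegaMeasure d k) := by
  set V := (volume : Measure (EuclideanSpace ℝ (Fin k))) (Metric.ball 0 1) with hV
  have hVt : V ≠ ⊤ := measure_ball_lt_top.ne
  have h := lintegral_inv_one_add_pow_le (μ := omegaMeasure d k) (r := fun y => ‖y.2‖)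
    (by fun_prop) (fun _ => norm_nonneg _) (A := V) (n := k) fun l => by
      have : {z : Omega d k | ‖z.2‖ ≤ 2 ^ l} = Set.univ ×ˢ Metric.closedBall 0 (2 ^ l) := by
        ext z; simp
      rw [this, Measure.prod_prod, measure_univ, one_mul,
        Measure.addHaar_closedBall _ _ (by positivity), finrank_euclideanSpace_fin, mul_comm,
        ← pow_mul, ENNReal.ofReal_pow two_pos.le]
      simp [hV]
  refine ⟨by fun_prop, ?_⟩
  rw [hasFiniteIntegral_iff_ofReal (ae_of_all _ fun _ => by positivity)]
  exact h.trans_lt (ENNReal.mul_lt_top (by simp) hVt.lt_top)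

/-! ### Characters, the covering map and translations -/

theorem norm_character (z : Omega d k) (ξ : OmegaDual d k) : ‖character z ξ‖ = 1 := by
  simp only [character, norm_mul, norm_prod, fourier_apply, Circle.norm_coe, Finset.prod_const_one,
    one_mul]
  rw [mul_comm]
  exact Complex.norm_exp_ofReal_mul_I _

theorem character_add_left (z w : Omega d k) (ξ : OmegaDual d k) :
    character (z + w) ξ = character z ξ * character w ξ := by
  simp only [character, fourier_apply, Prod.fst_add, Pi.add_apply, smul_add,
    AddCircle.toCircle_add, Circle.coe_mul, Finset.prod_mul_distrib, Prod.snd_add, inner_add_left,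
    Complex.ofReal_add, mul_add, Complex.exp_add]
  ring

theorem character_add_right (z : Omega d k) (ξ η : OmegaDual d k) :
    character z (ξ + η) = character z ξ * character z η := by
  simp only [character, fourier_apply, Prod.fst_add, Pi.add_apply, add_smul,
    AddCircle.toCircle_add, Circle.coe_mul, Finset.prod_mul_distrib, Prod.snd_add, inner_add_right,
    Complex.ofReal_add, mul_add, Complex.exp_add]
  ring

theorem continuous_character :
    Continuous fun p : Omega d k × OmegaDual d k => character p.1 p.2 := by
  simp only [character]
  refine Continuous.mul (continuous_finsetProd _ fun i _ => ?_) (by fun_prop)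
  have h : Continuous fun p : AddCircle (2 * Real.pi) × ℤ => (fourier p.2 p.1 : ℂ) :=
    continuous_prod_of_discrete_right.2 fun n => (fourier n).continuous
  exact h.comp (by fun_prop :
    Continuous fun p : Omega d k × OmegaDual d k => (p.1.1 i, p.2.1 i))

theorem isOpenQuotientMap_proj (d k : ℕ) : IsOpenQuotientMap (proj d k) := by
  let h : Eucl (d + k) ≃ₜ (Fin d → ℝ) × EuclideanSpace ℝ (Fin k) :=
    (PiLp.homeomorph 2 _).trans ((Fin.appendIsometry d k).symm.toHomeomorph.trans
      ((Homeomorph.refl _).prodCongr (PiLp.homeomorph 2 _).symm))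
  have h1 : IsOpenQuotientMap (Pi.map fun (_ : Fin d) (x : ℝ) => (x : AddCircle (2 * Real.pi))) :=
    IsOpenQuotientMap.piMap fun _ => QuotientAddGroup.isOpenQuotientMap_mk
  exact (h1.prodMap IsOpenQuotientMap.id).comp h.isOpenQuotientMap

theorem proj_add (x y : Eucl (d + k)) : proj d k (x + y) = proj d k x + proj d k y := by
  refine Prod.ext ?_ ?_
  · funext i
    simp [proj]
  · ext j
    simp [proj]

/-- Every point `z` of the circle is `e^{iθ}` with `|θ| = ‖z‖ ≤ π`. -/
theorem exists_angle (z : AddCircle (2 * Real.pi)) :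
    ∃ θ : ℝ, (θ : AddCircle (2 * Real.pi)) = z ∧ |θ| = ‖z‖ ∧ |θ| ≤ Real.pi := by
  have hp : (2 * Real.pi) ≠ 0 := Real.two_pi_pos.ne'
  have hle := AddCircle.norm_le_half_period (2 * Real.pi) (x := z) hp
  rw [abs_of_pos Real.two_pi_pos] at hle
  induction z using QuotientAddGroup.induction_on with
  | H x =>
    refine ⟨x - round ((2 * Real.pi)⁻¹ * x) * (2 * Real.pi), ?_, ?_, ?_⟩
    · rw [← zsmul_eq_mul, AddCircle.coe_sub, AddCircle.coe_zsmul, AddCircle.coe_period, smul_zero,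
        sub_zero]
    · exact (AddCircle.norm_eq (2 * Real.pi)).symm
    · rw [← AddCircle.norm_eq]
      linarith

/-! ### Decay of oscillatory integrals over the dual group -/

theorem pow_mul_le_of_le_sum {ι : Type*} [Fintype ι] {c : ι → ℝ} (hc : ∀ i, 0 ≤ c i) {t X M : ℝ}
    (ht : 0 ≤ t) (htc : t ≤ ∑ i, c i) (hX : 0 ≤ X) {n : ℕ}
    (h : ∀ i, c i ^ (n + 1) * X ≤ M) :
    t ^ (n + 1) * X ≤ (Fintype.card ι : ℝ) ^ (n + 1) * M := by
  have h1 : t ^ (n + 1) ≤ (Fintype.card ι : ℝ) ^ n * ∑ i, c i ^ (n + 1) :=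
    (pow_le_pow_left₀ ht htc _).trans
      (pow_sum_le_card_mul_sum_pow (fun i _ => hc i) n)
  calc t ^ (n + 1) * X ≤ (Fintype.card ι : ℝ) ^ n * (∑ i, c i ^ (n + 1)) * X := by gcongr
    _ = (Fintype.card ι : ℝ) ^ n * ∑ i, c i ^ (n + 1) * X := by rw [mul_assoc, Finset.sum_mul]
    _ ≤ (Fintype.card ι : ℝ) ^ n * ∑ _i : ι, M := by gcongr with i; exact h i
    _ = _ := by rw [Finset.sum_const, nsmul_eq_mul, Finset.card_univ]; ring

/-- The step `h` of a difference operator drops out of the estimate it gives. -/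
theorem pow_mul_le_of_scaled {c h X Y : ℝ} (hh : 0 < h) {N : ℕ}
    (H : (2 / Real.pi * (h * c)) ^ N * X ≤ h ^ N * Y) : c ^ N * X ≤ (Real.pi / 2) ^ N * Y := by
  have hπ := Real.pi_pos
  have hone : (2 / Real.pi) ^ N * (Real.pi / 2) ^ N = 1 := by
    rw [← mul_pow, div_mul_div_comm, mul_comm, div_self (by positivity), one_pow]
  have e1 : (2 / Real.pi * (h * c)) ^ N * X = (2 / Real.pi * h) ^ N * (c ^ N * X) := by
    rw [← mul_assoc, mul_pow]; ring
  have e2 : h ^ N * Y = (2 / Real.pi * h) ^ N * ((Real.pi / 2) ^ N * Y) := by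
    rw [mul_pow (2 / Real.pi) h]
    linear_combination (-(h ^ N * Y)) * hone
  rw [e1, e2] at H
  exact le_of_mul_le_mul_left H (by positivity)

theorem exists_step (c : ℝ) : ∃ h : ℝ, 0 < h ∧ h ≤ 1 ∧ h * |c| ≤ Real.pi := by
  have hπ := Real.pi_pos
  have hc := abs_nonneg c
  refine ⟨Real.pi / (Real.pi + |c|), by positivity,
    div_le_one_of_le₀ (by linarith) (by positivity), ?_⟩
  rw [div_mul_eq_mul_div, div_le_iff₀ (by positivity)]
  nlinarith

theorem norm_le_sum_abs {n : ℕ} (x : Eucl n) : ‖x‖ ≤ ∑ i, |x i| := by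
  rw [EuclideanSpace.norm_eq]
  refine Real.sqrt_le_iff.2 ⟨by positivity, ?_⟩
  simpa using Finset.sum_sq_le_sq_sum_of_nonneg (s := Finset.univ) (f := fun i => |x i|)

theorem norm_le_sum_coords (z : Omega d k) :
    ‖z‖ ≤ ∑ i : Fin d ⊕ Fin k, Sum.elim (fun i => ‖z.1 i‖) (fun j => |z.2 j|) i := by
  rw [Fintype.sum_sum_type]
  simp only [Sum.elim_inl, Sum.elim_inr]
  refine max_le ?_ ?_
  · refine le_add_of_le_of_nonneg ?_ (by positivity)
    refine (pi_norm_le_iff_of_nonneg (by positivity)).2 fun i => ?_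
    exact Finset.single_le_sum (f := fun i => ‖z.1 i‖) (fun _ _ => norm_nonneg _)
      (Finset.mem_univ i)
  · exact le_add_of_nonneg_of_le (by positivity) (norm_le_sum_abs z.2)

/-- Integral bound for a bounded function supported in a ball of `Ω^*`. -/
theorem exists_integral_norm_le_of_support (d k : ℕ) : ∃ A : ℝ, 0 ≤ A ∧
    ∀ (g : OmegaDual d k → ℂ) (r b : ℝ), AEStronglyMeasurable g (dualMeasure d k) → 1 ≤ r →
      (∀ ξ, ‖g ξ‖ ≤ b) → (∀ ξ, r < ‖dualIncl ξ‖ → g ξ = 0) →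
      Integrable g (dualMeasure d k) ∧ ∫ ξ, ‖g ξ‖ ∂dualMeasure d k ≤ A * r ^ (d + k) * b := by
  obtain ⟨A, hA⟩ := exists_dualMeasure_le d k
  refine ⟨A, A.2, fun g r b hg hr hb hs => ?_⟩
  set S : Set (OmegaDual d k) := {ξ | ‖dualIncl ξ‖ ≤ r} with hS
  have hSm : MeasurableSet S :=
    measurableSet_le continuous_dualIncl.norm.measurable measurable_const
  have hSfin : dualMeasure d k S ≠ ⊤ :=
    ((hA r hr).trans_lt (ENNReal.mul_lt_top (by simp) (by simp))).ne
  have hle : ∀ ξ, ‖g ξ‖ ≤ S.indicator (fun _ => b) ξ := by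
    intro ξ
    by_cases h : ξ ∈ S
    · simpa [h] using hb ξ
    · simp only [h, not_false_eq_true, Set.indicator_of_notMem]
      rw [hs ξ (not_le.1 h), norm_zero]
  have hint : Integrable (S.indicator fun _ => b) (dualMeasure d k) :=
    (integrable_indicator_iff hSm).2 (integrableOn_const hSfin)
  have hgint : Integrable g (dualMeasure d k) := hint.mono' hg (ae_of_all _ hle)
  have hb0 : 0 ≤ b := (norm_nonneg _).trans (hb 0)
  refine ⟨hgint, (integral_mono hgint.norm hint hle).trans ?_⟩
  rw [integral_indicator_const _ hSm, smul_eq_mul]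
  refine mul_le_mul_of_nonneg_right ?_ hb0
  refine ENNReal.toReal_le_of_le_ofReal (by positivity) ((hA r hr).trans (le_of_eq ?_))
  rw [ENNReal.ofReal_mul A.coe_nonneg, ENNReal.ofReal_pow (by linarith)]
  simp

theorem character_neg_single_fst (z : Omega d k) (i : Fin d) {θ : ℝ}
    (hθ : (θ : AddCircle (2 * Real.pi)) = z.1 i) :
    character z (-(Pi.single i 1, 0)) = Complex.exp (Complex.I * ((-θ : ℝ) : ℂ)) := by
  have h2 : (2 * (Real.pi : ℂ)) ≠ 0 := by exact_mod_cast Real.two_pi_pos.ne'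
  simp only [character, Prod.fst_neg, Prod.snd_neg, Pi.neg_apply, neg_zero, inner_zero_right,
    Complex.ofReal_zero, mul_zero, Complex.exp_zero, mul_one]
  rw [Finset.prod_eq_single i]
  · rw [Pi.single_eq_same, ← hθ, fourier_coe_apply]
    congr 1
    push_cast
    field_simp
  · intro j _ hj
    rw [Pi.single_eq_of_ne hj, neg_zero, fourier_zero]
  · simp

theorem character_neg_single_snd (z : Omega d k) (j : Fin k) (h : ℝ) :
    character z (-((0 : Fin d → ℤ), EuclideanSpace.single j h)) =
      Complex.exp (Complex.I * ((-(h * z.2 j) : ℝ) : ℂ)) := by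
  simp [character, EuclideanSpace.inner_single_right, inner_neg_right]

theorem dualIncl_single_fst (i : Fin d) :
    dualIncl ((Pi.single i 1, 0) : OmegaDual d k) = (1 : ℝ) • stdVec (Fin.castAdd k i) := by
  rw [one_smul]
  apply eucl_ext
  · intro j
    simp only [dualIncl_castAdd, stdVec, PiLp.single_apply, Fin.castAdd_inj, Pi.single_apply]
    split_ifs <;> simp
  · intro j
    simp [dualIncl_natAdd, stdVec, Fin.ext_iff]
    omega

theorem dualIncl_single_snd (j : Fin k) (h : ℝ) :
    dualIncl (((0 : Fin d → ℤ), EuclideanSpace.single j h) : OmegaDual d k) =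
      h • stdVec (Fin.natAdd d j) := by
  apply eucl_ext
  · intro i
    simp [dualIncl_castAdd, stdVec, Fin.ext_iff]
    omega
  · intro i
    simp [dualIncl_natAdd, stdVec, Fin.ext_iff]

/-- The kernel bound: if `f` is supported in `|ξ| ≤ ρ` and obeys the symbol estimates of size `B`
at frequency `ρ`, then its inverse Fourier transform over `Ω^*` is at most
`C B ρ^n (1 + ρ|z|)^{-(n+1)}`. Decay in a periodic variable comes from unit differences in `ξ`,
decay in an unbounded one from differences with a step so small that the phase stays below `π`. -/
theorem exists_norm_integral_character_le (d k : ℕ) : ∃ C : ℝ, 0 ≤ C ∧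
    ∀ (ρ B : ℝ) (f : Eucl (d + k) → ℂ), 1 ≤ ρ → 0 ≤ B → ContDiff ℝ ∞ f →
      (∀ ξ, ρ < ‖ξ‖ → f ξ = 0) → (∀ ξ, ‖f ξ‖ ≤ B) →
      (∀ i ξ, ‖((dirDeriv (stdVec i))^[d + k + 1] f) ξ‖ ≤ B * ρ⁻¹ ^ (d + k + 1)) →
      ∀ z : Omega d k, ‖∫ ξ, f (dualIncl ξ) * character z ξ ∂dualMeasure d k‖ ≤
        C * B * ρ ^ (d + k) * ((1 + ρ * ‖z‖) ^ (d + k + 1))⁻¹ := by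
  obtain ⟨A, hA0, hA⟩ := exists_integral_norm_le_of_support d k
  set n := d + k with hn
  set N := n + 1 with hN
  refine ⟨2 ^ n * A * (1 + n ^ N * ((Real.pi / 2) ^ N * (N + 1) ^ n)), by positivity,
    fun ρ B f hρ hB hf hsupp hfB hder z => ?_⟩
  have hρ0 : 0 < ρ := by linarith
  have hπ := Real.pi_pos
  have hfm : AEStronglyMeasurable (fun ξ : OmegaDual d k => f (dualIncl ξ)) (dualMeasure d k) :=
    (hf.continuous.comp continuous_dualIncl).aestronglyMeasurable
  obtain ⟨hfint, hfnorm⟩ := hA _ ρ B hfm hρ (fun ξ => hfB _) (fun ξ => hsupp _)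
  have hch : Measurable fun ξ : OmegaDual d k => character z ξ :=
    (continuous_character.comp (Continuous.prodMk_right z)).measurable
  set I := ∫ ξ, f (dualIncl ξ) * character z ξ ∂dualMeasure d k with hI
  have htriv : ‖I‖ ≤ A * ρ ^ n * B := by
    refine (norm_integral_le_integral_norm _).trans ?_
    simpa only [norm_mul, norm_character, mul_one] using hfnorm
  -- decay along one coordinate, from differences of step `h` in the dual variable
  have hdir : ∀ (i : Fin n) (h θ : ℝ) (v : OmegaDual d k), 0 ≤ h → h ≤ 1 →
      dualIncl v = h • stdVec i → |θ| ≤ Real.pi →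
      character z (-v) = Complex.exp (Complex.I * θ) →
      (2 / Real.pi * |θ|) ^ N * ‖I‖ ≤
        A * ((N + 1) * ρ) ^ n * (h ^ N * (B * ρ⁻¹ ^ N)) := by
    intro i h θ v h0 h1 hv hθ hcv
    refine (mul_norm_integral_mul_le hfint hch (character_add_right z) (norm_character z) hθ hcv
      N).trans ?_
    have heq := fwdDiff_iterate_comp (φ := (dualIncl : OmegaDual d k → _)) (h := v)
      (h' := h • stdVec i) (fun x => by rw [dualIncl_add, hv]) f N
    rw [heq]
    refine (hA _ ((N + 1) * ρ) _ ?_ (by nlinarith [(Nat.cast_nonneg N : (0 : ℝ) ≤ N)])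
      (fun ξ => norm_fwdDiff_iterate_le hf _ _ h0 N fun t _ => hder i _) ?_).2
    · rw [← heq]
      exact (integrable_fwdDiff_iterate hfint v N).aestronglyMeasurable
    · intro ξ hξ
      rw [fwdDiff_iter_eq_sum_shift]
      refine Finset.sum_eq_zero fun j hj => ?_
      rw [hsupp, smul_zero]
      have hj' : (j : ℝ) ≤ N := by
        exact_mod_cast Nat.lt_succ_iff.1 (Finset.mem_range.1 hj)
      have hnorm : ‖j • h • (stdVec i : Eucl n)‖ ≤ N := by
        rw [← Nat.cast_smul_eq_nsmul ℝ, norm_smul, norm_smul]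
        simp only [stdVec, PiLp.norm_single, norm_one, mul_one, Real.norm_eq_abs,
          Nat.abs_cast, abs_of_nonneg h0]
        calc (j : ℝ) * h ≤ j * 1 := by gcongr
          _ ≤ N := by rwa [mul_one]
      have := norm_sub_le (dualIncl ξ + j • h • stdVec i) (j • h • stdVec i)
      rw [add_sub_cancel_right] at this
      have : (N : ℝ) ≤ N * ρ := le_mul_of_one_le_right (Nat.cast_nonneg N) hρ
      linarith
  set M := (Real.pi / 2) ^ N * (A * ((N + 1) * ρ) ^ n * (B * ρ⁻¹ ^ N)) with hM
  have hcoord : ∀ i : Fin d ⊕ Fin k,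
      (Sum.elim (fun i => ‖z.1 i‖) (fun j => |z.2 j|) i) ^ N * ‖I‖ ≤ M := by
    rintro (i | j)
    · obtain ⟨θ, hθ, hθn, hθπ⟩ := exists_angle (z.1 i)
      have := hdir (Fin.castAdd k i) 1 (-θ) _ zero_le_one le_rfl (dualIncl_single_fst i)
        (by rwa [abs_neg]) (character_neg_single_fst z i hθ)
      refine pow_mul_le_of_scaled one_pos ?_
      simpa [hθn] using this
    · obtain ⟨h, hh0, hh1, hθπ⟩ := exists_step (z.2 j)
      have hθ : |(-(h * z.2 j))| = h * |z.2 j| := by rw [abs_neg, abs_mul, abs_of_pos hh0]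
      have := hdir (Fin.natAdd d j) h _ _ hh0.le hh1 (dualIncl_single_snd j h)
        (hθ.trans_le hθπ) (character_neg_single_snd z j h)
      refine pow_mul_le_of_scaled hh0 ?_
      rw [hθ] at this
      exact this.trans (le_of_eq (by ring))
  have hz := pow_mul_le_of_le_sum (n := n) (X := ‖I‖) (M := M) (t := ‖z‖)
    (by rintro (i | j) <;> simp) (norm_nonneg z) (norm_le_sum_coords z) (norm_nonneg I) hcoord
  rw [Fintype.card_sum, Fintype.card_fin, Fintype.card_fin, ← hn] at hz
  rw [← div_eq_mul_inv, le_div_iff₀ (by positivity), mul_comm]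
  have hbin := add_pow_le (zero_le_one) (by positivity : 0 ≤ ρ * ‖z‖) N
  rw [one_pow, hN, Nat.add_sub_cancel, ← hN] at hbin
  have hρN : ρ ^ N * ρ⁻¹ ^ N = 1 := by rw [← mul_pow, mul_inv_cancel₀ hρ0.ne', one_pow]
  calc (1 + ρ * ‖z‖) ^ N * ‖I‖ ≤ 2 ^ n * (1 + (ρ * ‖z‖) ^ N) * ‖I‖ := by gcongr
    _ = 2 ^ n * (‖I‖ + ρ ^ N * (‖z‖ ^ N * ‖I‖)) := by rw [mul_pow]; ring
    _ ≤ 2 ^ n * (A * ρ ^ n * B + ρ ^ N * ((n : ℝ) ^ N * M)) := by gcongr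
    _ = _ := by
        rw [hM, mul_pow ((N : ℝ) + 1) ρ]
        linear_combination (2 ^ n * (n : ℝ) ^ N * (Real.pi / 2) ^ N * A * (N + 1) ^ n * ρ ^ n * B)
          * hρN

end Domain

/-! ### Integral operators and the Schur test -/

section Kernel

variable {X : Type*} [MeasurableSpace X] {μ : Measure X}

/-- The hypothesis of the Schur test, with constant `C`: the `L¹` norms of `K(x, ·)` and `K(·, y)`
are at most `C`. -/
structure SchurBound (μ : Measure X) (K : X → X → ℂ) (C : NNReal) : Prop where
  measurable : Measurable (Function.uncurry K)
  left : ∀ x, ∫⁻ y, ‖K x y‖ₑ ∂μ ≤ C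
  right : ∀ y, ∫⁻ x, ‖K x y‖ₑ ∂μ ≤ C

/-- `T` is the operator on `L²` with kernel `K`; the defining integral converges for almost
every `x`. -/
def IsKernelOp (μ : Measure X) (K : X → X → ℂ) (T : Lp ℂ 2 μ →L[ℂ] Lp ℂ 2 μ) : Prop :=
  ∀ u : Lp ℂ 2 μ, ∀ᵐ x ∂μ, Integrable (fun y => K x y * u y) μ ∧ T u x = ∫ y, K x y * u y ∂μ

theorem IsKernelOp.add {K K' : X → X → ℂ} {T T' : Lp ℂ 2 μ →L[ℂ] Lp ℂ 2 μ}
    (h : IsKernelOp μ K T) (h' : IsKernelOp μ K' T') :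
    IsKernelOp μ (fun x y => K x y + K' x y) (T + T') := by
  intro u
  filter_upwards [h u, h' u, Lp.coeFn_add (T u) (T' u)] with x hx hx' hadd
  simp only [add_mul]
  refine ⟨hx.1.add hx'.1, ?_⟩
  rw [_root_.add_apply, hadd, Pi.add_apply, hx.2, hx'.2, integral_add hx.1 hx'.1]

theorem IsKernelOp.sub {K K' : X → X → ℂ} {T T' : Lp ℂ 2 μ →L[ℂ] Lp ℂ 2 μ}
    (h : IsKernelOp μ K T) (h' : IsKernelOp μ K' T') :
    IsKernelOp μ (fun x y => K x y - K' x y) (T - T') := by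
  intro u
  filter_upwards [h u, h' u, Lp.coeFn_sub (T u) (T' u)] with x hx hx' hsub
  simp only [sub_mul]
  refine ⟨hx.1.sub hx'.1, ?_⟩
  rw [_root_.sub_apply, hsub, Pi.sub_apply, hx.2, hx'.2, integral_sub hx.1 hx'.1]

theorem IsKernelOp.unique {K : X → X → ℂ} {T T' : Lp ℂ 2 μ →L[ℂ] Lp ℂ 2 μ}
    (h : IsKernelOp μ K T) (h' : IsKernelOp μ K T') : T = T' := by
  ext1 u
  refine Lp.ext ?_
  filter_upwards [h u, h' u] with x hx hx'
  rw [hx.2, hx'.2]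

/-- The rank-one operator with kernel `f(x) g(y)`. -/
theorem exists_isKernelOp_mul {f g : X → ℂ} (hf : MemLp f 2 μ) (hg : MemLp g 2 μ) :
    ∃ T : Lp ℂ 2 μ →L[ℂ] Lp ℂ 2 μ, IsKernelOp μ (fun x y => f x * g y) T ∧
      IsCompactOperator T := by
  let φ : Lp ℂ 2 μ →L[ℂ] ℂ := innerSL ℂ (hg.star.toLp _)
  let ι : ℂ →L[ℂ] Lp ℂ 2 μ := ContinuousLinearMap.toSpanSingleton ℂ (hf.toLp f)
  refine ⟨ι ∘L φ, fun u => ?_,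
    (isCompactOperator_of_locallyCompactSpace_dom φ).clm_comp ι⟩
  have hgu : Integrable (fun y => g y * u y) μ := hg.integrable_mul (Lp.memLp u)
  have hφ : φ u = ∫ y, g y * u y ∂μ := by
    change inner ℂ (hg.star.toLp _) u = _
    rw [L2.inner_def]
    refine integral_congr_ae ?_
    filter_upwards [hg.star.coeFn_toLp] with y hy
    rw [hy]
    simp [mul_comm]
  filter_upwards [hf.coeFn_toLp, Lp.coeFn_smul (φ u) (hf.toLp f)] with x hx hs
  constructor
  · simpa only [mul_assoc] using hgu.const_mul (f x)
  · change (φ u • hf.toLp f : Lp ℂ 2 μ) x = _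
    rw [hs, Pi.smul_apply, hx, hφ]
    simp only [mul_assoc]
    rw [integral_const_mul, smul_eq_mul, mul_comm]

theorem exists_isKernelOp_sum_mul {ι : Type*} (s : Finset ι) {f g : ι → X → ℂ}
    (hf : ∀ i, MemLp (f i) 2 μ) (hg : ∀ i, MemLp (g i) 2 μ) :
    ∃ T : Lp ℂ 2 μ →L[ℂ] Lp ℂ 2 μ, IsKernelOp μ (fun x y => ∑ i ∈ s, f i x * g i y) T ∧
      IsCompactOperator T := by
  classical
  induction s using Finset.induction_on with
  | empty =>
    refine ⟨0, fun u => ?_, isCompactOperator_zero⟩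
    filter_upwards [Lp.coeFn_zero ℂ 2 μ] with x hx
    refine ⟨by simp, ?_⟩
    rw [_root_.zero_apply, hx]
    simp
  | insert i s hi ih =>
    obtain ⟨T, hT, hTc⟩ := ih
    obtain ⟨T', hT', hTc'⟩ := exists_isKernelOp_mul (hf i) (hg i)
    refine ⟨T' + T, ?_, hTc'.add hTc⟩
    simpa only [Finset.sum_insert hi] using hT'.add hT

variable [SigmaFinite μ]

/-- Cauchy–Schwarz with the weight `|K(x, ·)|`, followed by Tonelli. -/
theorem SchurBound.lintegral_sq_le {K : X → X → ℂ} {C : NNReal} (hK : SchurBound μ K C)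
    {g : X → ℝ≥0∞} (hg : Measurable g) :
    ∫⁻ x, (∫⁻ y, ‖K x y‖ₑ * g y ∂μ) ^ (2 : ℝ) ∂μ ≤
      (C : ℝ≥0∞) ^ (2 : ℝ) * ∫⁻ y, g y ^ (2 : ℝ) ∂μ := by
  have hk : Measurable fun p : X × X => ‖K p.1 p.2‖ₑ := hK.measurable.enorm
  have hkx : ∀ x, Measurable fun y => ‖K x y‖ₑ := fun x => hk.comp measurable_prodMk_left
  have hky : ∀ y, Measurable fun x => ‖K x y‖ₑ := fun y => hk.comp measurable_prodMk_right
  have hsq : ∀ a : ℝ≥0∞, (a ^ (1 / 2 : ℝ)) ^ (2 : ℝ) = a := fun a => by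
    rw [← ENNReal.rpow_mul]; norm_num
  have h1 : ∀ x, (∫⁻ y, ‖K x y‖ₑ * g y ∂μ) ^ (2 : ℝ) ≤
      C * ∫⁻ y, ‖K x y‖ₑ * g y ^ (2 : ℝ) ∂μ := by
    intro x
    have := ENNReal.lintegral_mul_le_Lp_mul_Lq μ Real.HolderConjugate.two_two
      (f := fun y => ‖K x y‖ₑ ^ (1 / 2 : ℝ)) (g := fun y => ‖K x y‖ₑ ^ (1 / 2 : ℝ) * g y)
      ((hkx x).pow_const _).aemeasurable (((hkx x).pow_const _).mul hg).aemeasurable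
    have e : ∀ y, ((fun y => ‖K x y‖ₑ ^ (1 / 2 : ℝ)) * fun y => ‖K x y‖ₑ ^ (1 / 2 : ℝ) * g y) y =
        ‖K x y‖ₑ * g y := by
      intro y
      simp only [Pi.mul_apply]
      rw [← mul_assoc, ← ENNReal.rpow_add_of_nonneg _ _ (by norm_num) (by norm_num)]
      norm_num
    simp only [e, ENNReal.mul_rpow_of_nonneg _ _ zero_le_two, hsq] at this
    calc _ ≤ ((∫⁻ y, ‖K x y‖ₑ ∂μ) ^ (1 / 2 : ℝ) *
          (∫⁻ y, ‖K x y‖ₑ * g y ^ (2 : ℝ) ∂μ) ^ (1 / 2 : ℝ)) ^ (2 : ℝ) :=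
          ENNReal.rpow_le_rpow this zero_le_two
      _ = (∫⁻ y, ‖K x y‖ₑ ∂μ) * ∫⁻ y, ‖K x y‖ₑ * g y ^ (2 : ℝ) ∂μ := by
          rw [ENNReal.mul_rpow_of_nonneg _ _ zero_le_two, hsq, hsq]
      _ ≤ _ := by gcongr; exact hK.left x
  have hm : Measurable fun p : X × X => ‖K p.1 p.2‖ₑ * g p.2 ^ (2 : ℝ) :=
    hk.mul ((hg.comp measurable_snd).pow_const _)
  calc _ ≤ ∫⁻ x, C * ∫⁻ y, ‖K x y‖ₑ * g y ^ (2 : ℝ) ∂μ ∂μ := lintegral_mono h1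
    _ = C * ∫⁻ x, ∫⁻ y, ‖K x y‖ₑ * g y ^ (2 : ℝ) ∂μ ∂μ :=
        lintegral_const_mul _ hm.lintegral_prod_right'
    _ = C * ∫⁻ y, ∫⁻ x, ‖K x y‖ₑ * g y ^ (2 : ℝ) ∂μ ∂μ := by
        rw [lintegral_lintegral_swap hm.aemeasurable]
    _ = C * ∫⁻ y, (∫⁻ x, ‖K x y‖ₑ ∂μ) * g y ^ (2 : ℝ) ∂μ := by
        simp only [lintegral_mul_const _ (hky _)]
    _ ≤ C * ∫⁻ y, C * g y ^ (2 : ℝ) ∂μ := by gcongr with y; exact hK.right y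
    _ = _ := by
        rw [lintegral_const_mul _ (hg.pow_const _), ← mul_assoc, ENNReal.rpow_two, sq]

theorem SchurBound.ae_integrable {K : X → X → ℂ} {C : NNReal} (hK : SchurBound μ K C)
    (u : Lp ℂ 2 μ) : ∀ᵐ x ∂μ, Integrable (fun y => K x y * u y) μ := by
  have hu : Measurable u := (Lp.stronglyMeasurable u).measurable
  have hle := hK.lintegral_sq_le hu.enorm
  have hfin : ∫⁻ y, ‖u y‖ₑ ^ (2 : ℝ) ∂μ < ⊤ := by
    have := lintegral_rpow_enorm_lt_top_of_eLpNorm_lt_top two_ne_zero ENNReal.ofNat_ne_top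
      (Lp.memLp u).2
    simpa using this
  have hm : Measurable fun x => ∫⁻ y, ‖K x y‖ₑ * ‖u y‖ₑ ∂μ :=
    (hK.measurable.enorm.mul (hu.enorm.comp measurable_snd)).lintegral_prod_right'
  have hlt : ∫⁻ x, (∫⁻ y, ‖K x y‖ₑ * ‖u y‖ₑ ∂μ) ^ (2 : ℝ) ∂μ < ⊤ :=
    hle.trans_lt (ENNReal.mul_lt_top (ENNReal.rpow_lt_top_of_nonneg zero_le_two (by simp)) hfin)
  filter_upwards [ae_lt_top (hm.pow_const _) hlt.ne] with x hx
  refine ⟨((hK.measurable.comp measurable_prodMk_left).mul hu).aestronglyMeasurable, ?_⟩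
  simp only [HasFiniteIntegral, enorm_mul]
  exact (ENNReal.rpow_lt_top_iff_of_pos two_pos).1 hx

theorem SchurBound.eLpNorm_le {K : X → X → ℂ} {C : NNReal} (hK : SchurBound μ K C)
    (u : Lp ℂ 2 μ) : eLpNorm (fun x => ∫ y, K x y * u y ∂μ) 2 μ ≤ C * eLpNorm u 2 μ := by
  have hu : Measurable u := (Lp.stronglyMeasurable u).measurable
  rw [eLpNorm_eq_lintegral_rpow_enorm_toReal two_ne_zero ENNReal.ofNat_ne_top,
    eLpNorm_eq_lintegral_rpow_enorm_toReal two_ne_zero ENNReal.ofNat_ne_top, ENNReal.toReal_ofNat]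
  calc _ ≤ (∫⁻ x, (∫⁻ y, ‖K x y‖ₑ * ‖u y‖ₑ ∂μ) ^ (2 : ℝ) ∂μ) ^ (1 / 2 : ℝ) := by
        gcongr with x
        refine (enorm_integral_le_lintegral_enorm _).trans (le_of_eq ?_)
        simp only [enorm_mul]
    _ ≤ ((C : ℝ≥0∞) ^ (2 : ℝ) * ∫⁻ y, ‖u y‖ₑ ^ (2 : ℝ) ∂μ) ^ (1 / 2 : ℝ) := by
        gcongr
        exact hK.lintegral_sq_le hu.enorm
    _ = _ := by
        rw [ENNReal.mul_rpow_of_nonneg _ _ (by norm_num), ← ENNReal.rpow_mul]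
        norm_num

/-- **Schur test.** -/
theorem SchurBound.exists_isKernelOp {K : X → X → ℂ} {C : NNReal} (hK : SchurBound μ K C) :
    ∃ T : Lp ℂ 2 μ →L[ℂ] Lp ℂ 2 μ, IsKernelOp μ K T ∧ ‖T‖ ≤ C := by
  have hmem : ∀ u : Lp ℂ 2 μ, MemLp (fun x => ∫ y, K x y * u y ∂μ) 2 μ := by
    intro u
    have hu : Measurable u := (Lp.stronglyMeasurable u).measurable
    refine ⟨?_, (hK.eLpNorm_le u).trans_lt (ENNReal.mul_lt_top (by simp) (Lp.memLp u).2)⟩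
    exact (StronglyMeasurable.integral_prod_right' (f := fun p : X × X => K p.1 p.2 * u p.2)
      (hK.measurable.mul (hu.comp measurable_snd)).stronglyMeasurable).aestronglyMeasurable
  let L : Lp ℂ 2 μ →ₗ[ℂ] Lp ℂ 2 μ :=
    { toFun := fun u => (hmem u).toLp _
      map_add' := by
        intro u v
        refine Lp.ext ?_
        filter_upwards [(hmem (u + v)).coeFn_toLp, (hmem u).coeFn_toLp, (hmem v).coeFn_toLp,
          Lp.coeFn_add ((hmem u).toLp _) ((hmem v).toLp _), hK.ae_integrable u,
          hK.ae_integrable v] with x h1 h2 h3 h4 h5 h6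
        rw [h1, h4, Pi.add_apply, h2, h3, ← integral_add h5 h6]
        refine integral_congr_ae ?_
        filter_upwards [Lp.coeFn_add u v] with y hy
        rw [hy, Pi.add_apply, mul_add]
      map_smul' := by
        intro c u
        refine Lp.ext ?_
        filter_upwards [(hmem (c • u)).coeFn_toLp, (hmem u).coeFn_toLp,
          Lp.coeFn_smul c ((hmem u).toLp _)] with x h1 h2 h3
        rw [h1, RingHom.id_apply, h3, Pi.smul_apply, h2, smul_eq_mul, ← integral_const_mul]
        refine integral_congr_ae ?_
        filter_upwards [Lp.coeFn_smul c u] with y hy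
        rw [hy, Pi.smul_apply, smul_eq_mul]
        ring }
  have hL : ∀ u, ‖L u‖ ≤ C * ‖u‖ := by
    intro u
    have h1 : ‖L u‖ = (eLpNorm (fun x => ∫ y, K x y * u y ∂μ) 2 μ).toReal := Lp.norm_toLp _ (hmem u)
    rw [h1, Lp.norm_def]
    refine (ENNReal.toReal_mono (ENNReal.mul_ne_top (by simp) (Lp.memLp u).2.ne)
      (hK.eLpNorm_le u)).trans (le_of_eq ?_)
    rw [ENNReal.toReal_mul, ENNReal.coe_toReal]
  refine ⟨L.mkContinuous C hL, fun u => ?_, L.mkContinuous_norm_le C.2 hL⟩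
  filter_upwards [hK.ae_integrable u, (hmem u).coeFn_toLp] with x h1 h2
  exact ⟨h1, h2⟩

theorem IsKernelOp.norm_le {K : X → X → ℂ} {C : NNReal} {T : Lp ℂ 2 μ →L[ℂ] Lp ℂ 2 μ}
    (hT : IsKernelOp μ K T) (hK : SchurBound μ K C) : ‖T‖ ≤ C := by
  obtain ⟨T', hT', hn⟩ := hK.exists_isKernelOp
  rwa [hT.unique hT']

end Kernel

/-! ### Compactness of integral operators with continuous tight kernels -/

section Compact

/-- A measurable choice, with finitely many values, of a nearby centre in `t`. -/
theorem exists_simpleFunc_near {X : Type*} [MetricSpace X] [MeasurableSpace X] [BorelSpace X]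
    [Nonempty X] (t : Finset X) (η : ℝ) :
    ∃ π : SimpleFunc X X,
    ∀ x, (∃ c ∈ t, dist x c < η) → π x ∈ t ∧ dist x (π x) < η := by
  classical
  induction t using Finset.induction_on with
  | empty => exact ⟨SimpleFunc.const X (Classical.arbitrary X), by simp⟩
  | insert c t hc ih =>
    obtain ⟨π, hπ⟩ := ih
    refine ⟨SimpleFunc.piecewise (Metric.ball c η) measurableSet_ball (SimpleFunc.const X c) π,
      fun x hx => ?_⟩
    rw [SimpleFunc.piecewise_apply]
    split_ifs with h
    · exact ⟨by simp, h⟩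
    · obtain ⟨c', hc', hd⟩ := hx
      rcases Finset.mem_insert.1 hc' with rfl | h'
      · exact absurd hd h
      · exact ⟨Finset.mem_insert_of_mem (hπ x ⟨c', h', hd⟩).1, (hπ x ⟨c', h', hd⟩).2⟩

variable {X : Type*} [MetricSpace X] [ProperSpace X] [MeasurableSpace X] [BorelSpace X]
  {μ : Measure X} [SigmaFinite μ] [IsFiniteMeasureOnCompacts μ]

open Classical in
/-- A continuous kernel which, off some compact square `S × S`, has arbitrarily small Schur norm
defines a compact operator. On the square, uniform continuity lets the first variable be moved to
one of finitely many points, which leaves a kernel of finite rank. -/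
theorem isCompactOperator_of_tight [Nonempty X] {K : X → X → ℂ}
    (hK : Continuous (Function.uncurry K)) {T : Lp ℂ 2 μ →L[ℂ] Lp ℂ 2 μ}
    (hT : IsKernelOp μ K T)
    (htight : ∀ ε : NNReal, 0 < ε → ∃ S : Set X, IsCompact S ∧
      SchurBound μ (fun x y => if x ∈ S ∧ y ∈ S then 0 else K x y) ε) :
    IsCompactOperator T := by
  have hcl : T ∈ closure {F : Lp ℂ 2 μ →L[ℂ] Lp ℂ 2 μ | IsCompactOperator F} := by
    rw [Metric.mem_closure_iff]
    intro ε' hε'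
    lift ε' to NNReal using hε'.le
    have hε'0 : 0 < ε' := by exact_mod_cast hε'
    obtain ⟨ε, hε0, hεε'⟩ := exists_between hε'0
    obtain ⟨S, hS, hSb⟩ := htight (ε / 2) (half_pos hε0)
    have hSm : MeasurableSet S := hS.measurableSet
    set V : NNReal := (μ S).toNNReal with hV
    have hVS : μ S = V := (ENNReal.coe_toNNReal hS.measure_lt_top.ne).symm
    set δ : NNReal := ε / 2 / (V + 1) with hδ
    have hδ0 : 0 < δ := by positivity
    have hδV : δ * V ≤ ε / 2 := by
      rw [hδ, div_mul_eq_mul_div, div_le_iff₀ (by positivity)]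
      gcongr
      exact le_self_add
    obtain ⟨η, hη0, hη⟩ := Metric.uniformContinuousOn_iff.1
      ((hS.prod hS).uniformContinuousOn_of_continuous hK.continuousOn) δ (by exact_mod_cast hδ0)
    obtain ⟨t, htS, htfin, hcover⟩ := hS.finite_cover_balls hη0
    obtain ⟨π, hπ⟩ := exists_simpleFunc_near htfin.toFinset η
    have hπS : ∀ x ∈ S, π x ∈ S ∧ dist x (π x) < η := by
      intro x hx
      obtain ⟨c, hc, hxc⟩ := Set.mem_iUnion₂.1 (hcover hx)
      obtain ⟨h1, h2⟩ := hπ x ⟨c, by simpa using hc, hxc⟩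
      exact ⟨htS (by simpa using h1), h2⟩
    set f : X → X → ℂ := fun c => (S ∩ π ⁻¹' {c}).indicator fun _ => 1 with hf
    set g : X → X → ℂ := fun c => S.indicator (K c) with hg
    have hEm : ∀ c, MeasurableSet (S ∩ π ⁻¹' {c}) := fun c =>
      hSm.inter (π.measurableSet_preimage _)
    have hKc : ∀ c, Continuous (K c) := fun c => hK.comp (Continuous.prodMk_right c)
    have hfL : ∀ c, MemLp (f c) 2 μ := fun c =>
      memLp_indicator_const 2 (hEm c) 1
        (Or.inr ((measure_mono Set.inter_subset_left).trans_lt hS.measure_lt_top).ne)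
    have hgL : ∀ c, MemLp (g c) 2 μ := by
      intro c
      rw [hg, memLp_indicator_iff_restrict hSm]
      have : IsFiniteMeasure (μ.restrict S) :=
        ⟨by rw [Measure.restrict_apply_univ]; exact hS.measure_lt_top⟩
      obtain ⟨b, hb⟩ := hS.exists_bound_of_continuousOn (hKc c).continuousOn
      exact MemLp.of_bound (hKc c).aestronglyMeasurable b
        ((ae_restrict_iff' hSm).2 (ae_of_all _ hb))
    obtain ⟨F, hF, hFc⟩ := exists_isKernelOp_sum_mul π.range hfL hgL
    refine ⟨F, hFc, ?_⟩
    have hsum : ∀ x y, ∑ c ∈ π.range, f c x * g c y =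
        if x ∈ S ∧ y ∈ S then K (π x) y else 0 := by
      intro x y
      rw [Finset.sum_eq_single_of_mem (π x) (π.mem_range_self x)]
      · by_cases hx : x ∈ S <;> by_cases hy : y ∈ S <;> simp [hf, hg, hx, hy]
      · intro c _ hc
        have : x ∉ S ∩ π ⁻¹' {c} := fun h => hc h.2.symm
        simp [hf, this]
    have hsub : SchurBound μ (fun x y => K x y - ∑ c ∈ π.range, f c x * g c y) ε := by
      have hpt : ∀ x y, ‖K x y - ∑ c ∈ π.range, f c x * g c y‖ₑ ≤
          ‖if x ∈ S ∧ y ∈ S then 0 else K x y‖ₑ +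
            S.indicator (fun _ => S.indicator (fun _ => (δ : ℝ≥0∞)) y) x := by
        intro x y
        rw [hsum]
        by_cases h : x ∈ S ∧ y ∈ S
        · simp only [h, and_self, if_true, enorm_zero, zero_add, Set.indicator_of_mem]
          have := hη (x, y) ⟨h.1, h.2⟩ (π x, y) ⟨(hπS x h.1).1, h.2⟩ (by
            rw [Prod.dist_eq, dist_self, max_eq_left dist_nonneg]
            exact (hπS x h.1).2)
          rw [dist_eq_norm] at this
          rw [enorm_le_coe]
          exact_mod_cast this.le
        · simp only [h, if_false, sub_zero]
          exact le_self_add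
      have hhalf : (((ε / 2 : NNReal) : ℝ≥0∞)) + δ * μ S ≤ ε := by
        rw [hVS]
        have : ε / 2 + δ * V ≤ ε := by
          calc ε / 2 + δ * V ≤ ε / 2 + ε / 2 := by gcongr
            _ = ε := add_halves ε
        exact_mod_cast this
      have hind : ∀ (P : Prop) [Decidable P], (∫⁻ y, (if P then S.indicator
          (fun _ => (δ : ℝ≥0∞)) y else 0) ∂μ) ≤ δ * μ S := by
        intro P _
        split_ifs
        · rw [lintegral_indicator_const hSm]
        · simp
      refine ⟨?_, fun x => ?_, fun y => ?_⟩
      · refine Measurable.sub hK.measurable (Finset.measurable_fun_sum _ fun c _ => ?_)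
        exact ((measurable_const.indicator (hEm c)).comp measurable_fst).mul
          (((hKc c).measurable.indicator hSm).comp measurable_snd)
      · have hm : Measurable fun y => ‖if x ∈ S ∧ y ∈ S then 0 else K x y‖ₑ :=
          (hSb.measurable.comp measurable_prodMk_left).enorm
        refine (lintegral_mono (hpt x)).trans ?_
        rw [lintegral_add_left hm]
        refine (add_le_add (hSb.left x) ?_).trans hhalf
        simpa only [Set.indicator_apply (s := S) (a := x)] using hind (x ∈ S)
      · have hm : Measurable fun x => ‖if x ∈ S ∧ y ∈ S then 0 else K x y‖ₑ :=
          (hSb.measurable.comp measurable_prodMk_right).enorm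
        refine (lintegral_mono fun x => hpt x y).trans ?_
        rw [lintegral_add_left hm]
        refine (add_le_add (hSb.right y) ?_).trans hhalf
        rw [lintegral_indicator_const hSm]
        gcongr
        exact Set.indicator_le_self _ _ _
    have := (hT.sub hF).norm_le hsub
    rw [dist_eq_norm]
    exact lt_of_le_of_lt this (by exact_mod_cast hεε')
  rwa [isClosed_setOfPred_isCompactOperator.closure_eq] at hcl

end Compact

/-! ### Kernels dominated by a convolution kernel -/

section Convolution

variable {X : Type*} [NormedAddCommGroup X] [MeasurableSpace X] [BorelSpace X]
  {μ : Measure X} [μ.IsAddRightInvariant]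

/-- A kernel dominated by an even function `κ(x - y)` satisfies the Schur test with constant
`∫ κ`; evenness makes the two conditions of the test the same. -/
theorem schurBound_of_even {K : X → X → ℂ} (hK : Measurable (Function.uncurry K)) {κ : X → ℝ≥0∞}
    (heven : ∀ z, κ (-z) = κ z) (hle : ∀ x y, ‖K x y‖ₑ ≤ κ (x - y)) {C : NNReal}
    (hC : ∫⁻ z, κ z ∂μ ≤ C) : SchurBound μ K C := by
  refine ⟨hK, fun x => ?_, fun y => ?_⟩
  · refine (lintegral_mono (hle x)).trans (le_trans (le_of_eq ?_) hC)
    rw [← lintegral_sub_right_eq_self κ x]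
    refine lintegral_congr fun y => ?_
    rw [← heven, neg_sub]
  · refine (lintegral_mono fun x => hle x y).trans (le_trans (le_of_eq ?_) hC)
    exact lintegral_sub_right_eq_self κ y

open Classical in
/-- Tightness from two facts: the kernel is dominated by an integrable function of `x - y`, and it
tends to zero at infinity within each neighbourhood `|x - y| < R` of the diagonal. -/
theorem exists_schurBound_off_compact [ProperSpace X] [IsFiniteMeasureOnCompacts μ]
    {K : X → X → ℂ} (hK : Measurable (Function.uncurry K))
    {κ : X → ℝ≥0∞} (hκm : Measurable κ) (heven : ∀ z, κ (-z) = κ z)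
    (hle : ∀ x y, ‖K x y‖ₑ ≤ κ (x - y)) (hκ : ∫⁻ z, κ z ∂μ ≠ ⊤)
    (hnear : ∀ R ε : ℝ, 0 < R → 0 < ε → ∃ S : Set X, IsCompact S ∧
      ∀ x y, ¬ (x ∈ S ∧ y ∈ S) → dist x y < R → ‖K x y‖ ≤ ε)
    {ε : NNReal} (hε : 0 < ε) : ∃ S : Set X, IsCompact S ∧
      SchurBound μ (fun x y => if x ∈ S ∧ y ∈ S then 0 else K x y) ε := by
  set E : ℕ → Set X := fun R => {z | (R : ℝ) ≤ ‖z‖} with hE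
  have hEm : ∀ R, MeasurableSet (E R) := fun R => measurableSet_le measurable_const measurable_norm
  obtain ⟨R, hR0, hR⟩ : ∃ R : ℕ, 0 < R ∧ ∫⁻ z in E R, κ z ∂μ ≤ (ε / 2 : NNReal) := by
    have hanti : Antitone E := fun i j hij z hz => by
      have : (i : ℝ) ≤ j := by exact_mod_cast hij
      exact this.trans hz
    have hlim := tendsto_measure_iInter_atTop (μ := μ.withDensity κ)
      (fun i => (hEm i).nullMeasurableSet) hanti ⟨0, by
        rw [withDensity_apply _ (hEm 0)]
        exact ((setLIntegral_le_lintegral _ _).trans_lt hκ.lt_top).ne⟩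
    have hempty : ⋂ i, E i = ∅ := by
      refine Set.eq_empty_of_forall_notMem fun z hz => ?_
      obtain ⟨i, hi⟩ := exists_nat_gt ‖z‖
      exact absurd (Set.mem_iInter.1 hz i) (not_le.2 hi)
    rw [hempty, measure_empty] at hlim
    have hpos : (0 : ℝ≥0∞) < (ε / 2 : NNReal) := by exact_mod_cast half_pos hε
    obtain ⟨R, hR, hR0⟩ := ((hlim.eventually (ge_mem_nhds hpos)).and
      (eventually_gt_atTop 0)).exists
    rw [Function.comp_apply, withDensity_apply _ (hEm R)] at hR
    exact ⟨R, hR0, hR⟩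
  have hBfin : μ (E R)ᶜ < ⊤ := by
    refine (measure_mono ?_).trans_lt (measure_closedBall_lt_top (μ := μ) (x := 0) (r := R))
    intro z hz
    simpa using (not_le.1 (show ¬ (R : ℝ) ≤ ‖z‖ from hz)).le
  set V : NNReal := (μ (E R)ᶜ).toNNReal with hV
  have hVS : μ (E R)ᶜ = V := (ENNReal.coe_toNNReal hBfin.ne).symm
  set δ : NNReal := ε / 2 / (V + 1) with hδ
  have hδ0 : 0 < δ := by positivity
  have hδV : δ * V ≤ ε / 2 := by
    rw [hδ, div_mul_eq_mul_div, div_le_iff₀ (by positivity)]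
    gcongr
    exact le_self_add
  obtain ⟨S, hS, hSK⟩ := hnear R δ (by exact_mod_cast hR0) (by exact_mod_cast hδ0)
  refine ⟨S, hS, schurBound_of_even (κ := fun z => (E R).indicator κ z +
    (E R)ᶜ.indicator (fun _ => (δ : ℝ≥0∞)) z) ?_ ?_ ?_ ?_⟩
  · refine Measurable.ite ?_ measurable_const hK
    exact (hS.measurableSet.preimage measurable_fst).inter
      (hS.measurableSet.preimage measurable_snd)
  · intro z
    simp [Set.indicator_apply, hE, heven]
  · intro x y
    by_cases h : x ∈ S ∧ y ∈ S
    · simp [h]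
    · simp only [h, if_false]
      by_cases hxy : x - y ∈ E R
      · rw [Set.indicator_of_mem hxy]
        exact (hle x y).trans le_self_add
      · rw [Set.indicator_of_mem (s := (E R)ᶜ) hxy]
        refine le_trans ?_ le_add_self
        rw [enorm_le_coe]
        have := hSK x y h (by rw [dist_eq_norm]; exact not_le.1 hxy)
        exact_mod_cast this
  · rw [lintegral_add_left (hκm.indicator (hEm R)), lintegral_indicator (hEm R),
      lintegral_indicator_const (hEm R).compl, hVS]
    refine (add_le_add_left hR _).trans ?_
    have : ε / 2 + δ * V ≤ ε := by
      calc ε / 2 + δ * V ≤ ε / 2 + ε / 2 := by gcongr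
        _ = ε := add_halves ε
    exact_mod_cast this

end Convolution

/-! ### Frequency cutoffs -/

section Cutoff

variable {n : ℕ}

/-- The smooth cutoff at frequency `2^J`: it is `1` on `|ξ| ≤ 2^J` and `0` on `|ξ| ≥ 2^{J+1}`. -/
def cutoff (n J : ℕ) (ξ : Eucl n) : ℂ :=
  (((⟨1, 2, one_pos, one_lt_two⟩ : ContDiffBump (0 : Eucl n)) (((2 : ℝ) ^ J)⁻¹ • ξ) : ℝ) : ℂ)

theorem contDiff_cutoff (J : ℕ) : ContDiff ℝ ∞ (cutoff n J) :=
  Complex.ofRealCLM.contDiff.comp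
    ((ContDiffBump.contDiff _).comp (contDiff_const_smul _))

theorem cutoff_eq_one {J : ℕ} {ξ : Eucl n} (h : ‖ξ‖ ≤ 2 ^ J) : cutoff n J ξ = 1 := by
  rw [cutoff, ContDiffBump.one_of_mem_closedBall, Complex.ofReal_one]
  rw [mem_closedBall_zero_iff, norm_smul, norm_inv, Real.norm_of_nonneg (by positivity)]
  exact (inv_mul_le_one₀ (by positivity)).2 h

theorem cutoff_eq_zero {J : ℕ} {ξ : Eucl n} (h : 2 ^ (J + 1) ≤ ‖ξ‖) : cutoff n J ξ = 0 := by
  rw [cutoff, ContDiffBump.zero_of_le_dist, Complex.ofReal_zero]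
  rw [dist_zero_right, norm_smul, norm_inv, Real.norm_of_nonneg (by positivity)]
  rw [← div_eq_inv_mul, le_div_iff₀ (by positivity)]
  rw [pow_succ'] at h
  exact h

theorem norm_cutoff_le (J : ℕ) (ξ : Eucl n) : ‖cutoff n J ξ‖ ≤ 1 := by
  rw [cutoff, Complex.norm_real, Real.norm_of_nonneg (ContDiffBump.nonneg _)]
  exact ContDiffBump.le_one _

theorem tendsto_cutoff (ξ : Eucl n) : Tendsto (fun J => cutoff n J ξ) atTop (𝓝 1) := by
  refine tendsto_const_nhds.congr' ?_
  obtain ⟨J₀, hJ₀⟩ := pow_unbounded_of_one_lt ‖ξ‖ (one_lt_two)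
  filter_upwards [eventually_ge_atTop J₀] with J hJ
  exact (cutoff_eq_one (hJ₀.le.trans (pow_le_pow_right₀ one_le_two hJ))).symm

theorem exists_common_bound {E : Type*} {N : ℕ} {f : Fin n → ℕ → E → ℝ}
    (h : ∀ i, ∀ l ≤ N, ∃ C : ℝ, ∀ p, f i l p ≤ C) :
    ∃ C : ℝ, 0 ≤ C ∧ ∀ i, ∀ l ≤ N, ∀ p, f i l p ≤ C := by
  choose! C hC using h
  refine ⟨∑ i, ∑ l ∈ Finset.range (N + 1), |C i l|, by positivity, fun i l hl p => ?_⟩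
  calc f i l p ≤ |C i l| := (hC i l hl p).trans (le_abs_self _)
    _ ≤ ∑ l ∈ Finset.range (N + 1), |C i l| :=
        Finset.single_le_sum (f := fun l => |C i l|) (fun _ _ => abs_nonneg _)
          (Finset.mem_range.2 (Nat.lt_succ_of_le hl))
    _ ≤ _ := Finset.single_le_sum (f := fun i => ∑ l ∈ Finset.range (N + 1), |C i l|)
        (fun _ _ => Finset.sum_nonneg fun _ _ => abs_nonneg _) (Finset.mem_univ i)

theorem dirDeriv_iterate_eventuallyEq_zero {E : Type} [NormedAddCommGroup E] [NormedSpace ℝ E]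
    {F : E → ℂ} {p : E} (h : F =ᶠ[𝓝 p] 0) (v : E) (l : ℕ) : (dirDeriv v)^[l] F =ᶠ[𝓝 p] 0 := by
  induction l with
  | zero => exact h
  | succ l ih =>
    rw [Function.iterate_succ_apply']
    filter_upwards [ih.fderiv (𝕜 := ℝ)] with q hq
    simp [dirDeriv, hq]

/-- The cutoffs are symbols of order zero, uniformly in `J`. -/
theorem exists_cutoff_bound (n N : ℕ) : ∃ D : ℝ, 0 ≤ D ∧ ∀ (J : ℕ) (i : Fin n), ∀ l ≤ N,
    ∀ ξ : Eucl n, ‖((dirDeriv (stdVec i))^[l] (cutoff n J)) ξ‖ ≤ D * (1 + ‖ξ‖)⁻¹ ^ l := by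
  set F := cutoff n 0 with hF
  have hFs : ContDiff ℝ ∞ F := contDiff_cutoff 0
  have hzero : ∀ (v : Eucl n) (l : ℕ) (η : Eucl n), 2 < ‖η‖ → ((dirDeriv v)^[l] F) η = 0 := by
    intro v l η hη
    refine (dirDeriv_iterate_eventuallyEq_zero ?_ v l).eq_of_nhds
    filter_upwards [(isOpen_lt continuous_const continuous_norm).mem_nhds hη] with q hq
    exact cutoff_eq_zero (by simpa using (le_of_lt hq : (2 : ℝ) ≤ ‖q‖))
  obtain ⟨D, hD0, hD⟩ := exists_common_bound (n := n) (N := N)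
    (f := fun i l ξ => ‖((dirDeriv (stdVec i))^[l] F) ξ‖) fun i l _ => by
      have hc := (contDiff_dirDeriv_iterate hFs (stdVec i) l).continuous
      obtain ⟨C, hC⟩ := (isCompact_closedBall (0 : Eucl n) 2).exists_bound_of_continuousOn
        hc.continuousOn
      refine ⟨max C 0, fun ξ => ?_⟩
      by_cases h : ‖ξ‖ ≤ 2
      · exact (hC ξ (by simpa using h)).trans (le_max_left _ _)
      · rw [hzero _ _ _ (not_le.1 h), norm_zero]
        exact le_max_right _ _
  refine ⟨D * 4 ^ N, by positivity, fun J i l hl ξ => ?_⟩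
  have hscale : cutoff n J = fun ξ => F (((2 : ℝ) ^ J)⁻¹ • ξ) := by
    funext ξ; simp [hF, cutoff]
  rw [hscale, dirDeriv_iterate_comp_smul hFs, norm_mul, norm_pow, Complex.norm_real, norm_inv,
    Real.norm_of_nonneg (by positivity)]
  by_cases h : ‖((2 : ℝ) ^ J)⁻¹ • ξ‖ ≤ 2
  · have h1 : ((2 : ℝ) ^ J)⁻¹ ≤ 4 * (1 + ‖ξ‖)⁻¹ := by
      rw [norm_smul, norm_inv, Real.norm_of_nonneg (by positivity), ← div_eq_inv_mul,
        div_le_iff₀ (by positivity)] at h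
      rw [← div_eq_mul_inv, le_div_iff₀ (by positivity), ← div_eq_inv_mul,
        div_le_iff₀ (by positivity)]
      linarith [one_le_pow₀ (one_le_two : (1 : ℝ) ≤ 2) (n := J)]
    calc _ ≤ (4 * (1 + ‖ξ‖)⁻¹) ^ l * D := by
          gcongr
          exact hD i l hl _
      _ = D * 4 ^ l * (1 + ‖ξ‖)⁻¹ ^ l := by rw [mul_pow]; ring
      _ ≤ _ := by
          gcongr
          norm_num
  · rw [hzero _ _ _ (not_le.1 h), norm_zero, mul_zero]
    positivity

end Cutoff

/-! ### Amplitudes -/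

section Amplitude

variable {d k : ℕ} {m : ℝ} {a : Omega d k → Omega d k → Eucl (d + k) → ℂ}

theorem IsAmplitude.continuous (ha : IsAmplitude m a) :
    Continuous fun p : Omega d k × Omega d k × Eucl (d + k) => a p.1 p.2.1 p.2.2 := by
  have h := (isOpenQuotientMap_proj d k).prodMap
    ((isOpenQuotientMap_proj d k).prodMap (IsOpenQuotientMap.id (X := Eucl (d + k))))
  exact h.continuous_comp_iff.1 ha.smooth.continuous

theorem IsAmplitude.contDiff_right (ha : IsAmplitude m a) (x y : Omega d k) :
    ContDiff ℝ ∞ (a x y) := by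
  obtain ⟨x, rfl⟩ := (isOpenQuotientMap_proj d k).surjective x
  obtain ⟨y, rfl⟩ := (isOpenQuotientMap_proj d k).surjective y
  exact ha.smooth.comp (contDiff_const.prodMk (contDiff_const.prodMk contDiff_id))

theorem IsAmplitude.contDiff_mid (ha : IsAmplitude m a) (x : Omega d k) (ξ : Eucl (d + k)) :
    ContDiff ℝ ∞ fun y => a x (proj d k y) ξ := by
  obtain ⟨x, rfl⟩ := (isOpenQuotientMap_proj d k).surjective x
  exact ha.smooth.comp (contDiff_const.prodMk (contDiff_id.prodMk contDiff_const))

theorem IsAmplitude.exists_bound_right (ha : IsAmplitude m a) : ∃ C : ℝ, 0 ≤ C ∧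
    ∀ (x y : Omega d k) (i : Fin (d + k)), ∀ l ≤ d + k + 1, ∀ ξ,
      ‖((dirDeriv (stdVec i))^[l] (a x y)) ξ‖ ≤ C * (1 + ‖ξ‖) ^ m * (1 + ‖ξ‖)⁻¹ ^ l := by
  obtain ⟨C, hC0, hC⟩ := exists_common_bound (n := d + k) (N := d + k + 1)
    (f := fun i l (p : Eucl (d + k) × Eucl (d + k) × Eucl (d + k)) =>
      (1 + ‖p.2.2‖) ^ ((l : ℝ) - m) * ‖mixedDeriv 0 0 (Pi.single i l) (liftAmp a) p‖)
    fun i l hl => by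
      obtain ⟨C, hC⟩ := ha.bound 0 0 (Pi.single i l) (by simp [order_zero]) (by simp [order_zero])
        (by rwa [order_single])
      exact ⟨C, fun p => by simpa only [order_single] using hC p.1 p.2.1 p.2.2⟩
  refine ⟨C, hC0, fun x y i l hl ξ => ?_⟩
  obtain ⟨x, rfl⟩ := (isOpenQuotientMap_proj d k).surjective x
  obtain ⟨y, rfl⟩ := (isOpenQuotientMap_proj d k).surjective y
  have h := hC i l hl (x, y, ξ)
  have hφ : ContDiff ℝ ∞ fun ξ : Eucl (d + k) => (x, y, ξ) :=
    contDiff_const.prodMk (contDiff_const.prodMk contDiff_id)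
  have e := dirDeriv_iterate_comp ha.smooth hφ (v := (0, 0, stdVec i)) (w := stdVec i)
    (fun q t => by simp) l ξ
  simp only [mixedDeriv, multiDeriv_zero, multiDeriv_single] at h
  rw [← e] at h
  have hpos : 0 < 1 + ‖ξ‖ := by positivity
  rw [Real.rpow_sub hpos, Real.rpow_natCast, div_mul_eq_mul_div,
    div_le_iff₀ (Real.rpow_pos_of_pos hpos m)] at h
  rw [inv_pow, ← div_eq_mul_inv, le_div_iff₀ (by positivity), mul_comm]
  exact h

theorem IsAmplitude.exists_bound_mid (ha : IsAmplitude m a) (hm : m ≤ 0) : ∃ C : ℝ, 0 ≤ C ∧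
    ∀ (x : Omega d k) (ξ : Eucl (d + k)) (i : Fin (d + k)), ∀ l ≤ d + k + 1, ∀ y,
      ‖((dirDeriv (stdVec i))^[l] fun y => a x (proj d k y) ξ) y‖ ≤ C := by
  obtain ⟨C, hC0, hC⟩ := exists_common_bound (n := d + k) (N := d + k + 1)
    (f := fun i l (p : Eucl (d + k) × Eucl (d + k) × Eucl (d + k)) =>
      (1 + ‖p.2.2‖) ^ (((0 : ℕ) : ℝ) - m) * ‖mixedDeriv 0 (Pi.single i l) 0 (liftAmp a) p‖)
    fun i l hl => by
      obtain ⟨C, hC⟩ := ha.bound 0 (Pi.single i l) 0 (by simp [order_zero]) (by rwa [order_single])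
        (by simp [order_zero])
      exact ⟨C, fun p => by simpa only [order_zero] using hC p.1 p.2.1 p.2.2⟩
  refine ⟨C, hC0, fun x ξ i l hl y => ?_⟩
  obtain ⟨x, rfl⟩ := (isOpenQuotientMap_proj d k).surjective x
  have h := hC i l hl (x, y, ξ)
  have hφ : ContDiff ℝ ∞ fun y : Eucl (d + k) => (x, y, ξ) :=
    contDiff_const.prodMk (contDiff_id.prodMk contDiff_const)
  have e := dirDeriv_iterate_comp ha.smooth hφ (v := (0, stdVec i, 0)) (w := stdVec i)
    (fun q t => by simp) l y
  simp only [mixedDeriv, multiDeriv_zero, multiDeriv_single] at h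
  rw [← e] at h
  refine le_trans (le_mul_of_one_le_left (norm_nonneg _) ?_) h
  exact Real.one_le_rpow (by simp) (by simpa using hm)

theorem IsAmplitude.exists_norm_le_rpow (ha : IsAmplitude m a) : ∃ C : ℝ, 0 ≤ C ∧
    ∀ x y ξ, ‖a x y ξ‖ ≤ C * (1 + ‖ξ‖) ^ m := by
  obtain ⟨C, hC⟩ := ha.bound 0 0 0 (by simp [order_zero]) (by simp [order_zero])
    (by simp [order_zero])
  refine ⟨max C 0, le_max_right _ _, fun x y ξ => ?_⟩
  obtain ⟨x, rfl⟩ := (isOpenQuotientMap_proj d k).surjective x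
  obtain ⟨y, rfl⟩ := (isOpenQuotientMap_proj d k).surjective y
  have h := hC x y ξ
  have hpos : 0 < 1 + ‖ξ‖ := by positivity
  simp only [mixedDeriv, multiDeriv_zero, order_zero, Nat.cast_zero, zero_sub] at h
  rw [Real.rpow_neg hpos.le, ← div_eq_inv_mul, div_le_iff₀ (Real.rpow_pos_of_pos hpos m)] at h
  exact h.trans (mul_le_mul_of_nonneg_right (le_max_left _ _) (by positivity))

theorem IsAmplitude.exists_norm_le (ha : IsAmplitude m a) (hm : m ≤ 0) : ∃ C : ℝ, 0 ≤ C ∧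
    ∀ x y ξ, ‖a x y ξ‖ ≤ C := by
  obtain ⟨C, hC0, hC⟩ := ha.exists_norm_le_rpow
  exact ⟨C, hC0, fun x y ξ => (hC x y ξ).trans
    (mul_le_of_le_one_right hC0 (Real.rpow_le_one_of_one_le_of_nonpos (by simp) hm))⟩

/-! ### Kernels with a frequency cutoff -/

/-- The kernel `∫_{Ω^*} a(x,y,ξ) φ(ξ) e^{i(x-y)·ξ} dξ` of the operator whose amplitude is cut off
by `φ`. -/
def cutoffKernel (a : Omega d k → Omega d k → Eucl (d + k) → ℂ) (φ : Eucl (d + k) → ℂ)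
    (x y : Omega d k) : ℂ :=
  ∫ ξ, a x y (dualIncl ξ) * φ (dualIncl ξ) * character (x - y) ξ ∂dualMeasure d k

theorem continuous_cutoffIntegrand (ha : IsAmplitude m a) {φ : Eucl (d + k) → ℂ}
    (hφ : Continuous φ) : Continuous fun p : (Omega d k × Omega d k) × OmegaDual d k =>
      a p.1.1 p.1.2 (dualIncl p.2) * φ (dualIncl p.2) * character (p.1.1 - p.1.2) p.2 := by
  have h1 : Continuous fun p : (Omega d k × Omega d k) × OmegaDual d k => dualIncl p.2 :=
    continuous_dualIncl.comp continuous_snd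
  have h2 := ha.continuous.comp ((continuous_fst.comp continuous_fst).prodMk
    ((continuous_snd.comp continuous_fst).prodMk h1))
  have h3 := continuous_character.comp (((continuous_fst.comp continuous_fst).sub
    (continuous_snd.comp continuous_fst)).prodMk continuous_snd :
    Continuous fun p : (Omega d k × Omega d k) × OmegaDual d k => (p.1.1 - p.1.2, p.2))
  exact (h2.mul (hφ.comp h1)).mul h3

theorem integrable_cutoffIntegrand (ha : IsAmplitude m a) (hm : m ≤ 0) {φ : Eucl (d + k) → ℂ}
    (hφ : Continuous φ) {ρ D : ℝ} (hρ : 1 ≤ ρ) (hD : ∀ ξ, ‖φ ξ‖ ≤ D)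
    (hs : ∀ ξ, ρ < ‖ξ‖ → φ ξ = 0) (x y : Omega d k) :
    Integrable (fun ξ => a x y (dualIncl ξ) * φ (dualIncl ξ) * character (x - y) ξ)
      (dualMeasure d k) := by
  obtain ⟨A, -, hA⟩ := exists_integral_norm_le_of_support d k
  obtain ⟨C, hC0, hC⟩ := ha.exists_norm_le hm
  refine (hA _ ρ (C * D) ?_ hρ (fun ξ => ?_) fun ξ hξ => ?_).1
  · exact ((continuous_cutoffIntegrand ha hφ).comp
      (Continuous.prodMk_right (x, y))).aestronglyMeasurable
  · rw [norm_mul, norm_mul, norm_character, mul_one]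
    exact mul_le_mul (hC _ _ _) (hD _) (norm_nonneg _) hC0
  · rw [hs _ hξ, mul_zero, zero_mul]

theorem continuous_cutoffKernel (ha : IsAmplitude m a) (hm : m ≤ 0) {φ : Eucl (d + k) → ℂ}
    (hφ : Continuous φ) {ρ D : ℝ} (hρ : 1 ≤ ρ) (hD : ∀ ξ, ‖φ ξ‖ ≤ D)
    (hs : ∀ ξ, ρ < ‖ξ‖ → φ ξ = 0) :
    Continuous (Function.uncurry (cutoffKernel a φ)) := by
  obtain ⟨A, -, hA⟩ := exists_integral_norm_le_of_support d k
  obtain ⟨C, hC0, hC⟩ := ha.exists_norm_le hm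
  have hφint : Integrable (fun ξ : OmegaDual d k => φ (dualIncl ξ)) (dualMeasure d k) :=
    (hA _ ρ D (hφ.comp continuous_dualIncl).aestronglyMeasurable hρ (fun _ => hD _)
      fun ξ => hs _).1
  have hcont := continuous_cutoffIntegrand ha hφ
  refine continuous_of_dominated (bound := fun ξ => C * ‖φ (dualIncl ξ)‖) (fun p => ?_)
    (fun p => ae_of_all _ fun ξ => ?_) (hφint.norm.const_mul C) (ae_of_all _ fun ξ => ?_)
  · exact (hcont.comp (Continuous.prodMk_right p)).aestronglyMeasurable
  · rw [norm_mul, norm_mul, norm_character, mul_one]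
    exact mul_le_mul_of_nonneg_right (hC _ _ _) (norm_nonneg _)
  · exact hcont.comp (Continuous.prodMk_left ξ)

/-- The kernel of an amplitude of order `m ≤ 0` whose frequencies are confined to
`c ρ - 1 ≤ |ξ| ≤ ρ`. The constant is uniform in `ρ`. -/
theorem IsAmplitude.exists_norm_cutoffKernel_le (ha : IsAmplitude m a) (hm : m ≤ 0) :
    ∃ C : ℝ, 0 ≤ C ∧ ∀ (ρ c D : ℝ) (φ : Eucl (d + k) → ℂ), 1 ≤ ρ → 0 < c → c ≤ 1 → 0 ≤ D →
      ContDiff ℝ ∞ φ → (∀ ξ, ρ < ‖ξ‖ → φ ξ = 0) → (∀ ξ, 1 + ‖ξ‖ < c * ρ → φ ξ = 0) →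
      (∀ i, ∀ l ≤ d + k + 1, ∀ ξ,
        ‖((dirDeriv (stdVec i))^[l] φ) ξ‖ ≤ D * (1 + ‖ξ‖)⁻¹ ^ l) → (∀ ξ, ‖φ ξ‖ ≤ D) →
      ∀ x y : Omega d k, ‖cutoffKernel a φ x y‖ ≤
        C * (D * (c * ρ) ^ m * c⁻¹ ^ (d + k + 1)) * ρ ^ (d + k) *
          ((1 + ρ * ‖x - y‖) ^ (d + k + 1))⁻¹ := by
  obtain ⟨C₁, hC₁, hker⟩ := exists_norm_integral_character_le d k
  obtain ⟨C₂, hC₂, hsym⟩ := ha.exists_bound_right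
  obtain ⟨C₃, hC₃, hbd⟩ := ha.exists_norm_le_rpow
  set N := d + k + 1 with hN
  refine ⟨C₁ * (2 ^ N * C₂ + C₃), by positivity,
    fun ρ c D φ hρ hc hc1 hD hφ hout hin hder hφD x y => ?_⟩
  have hρ0 : 0 < ρ := by linarith
  have hcρ : 0 < c * ρ := by positivity
  set B := (2 ^ N * C₂ + C₃) * (D * (c * ρ) ^ m * c⁻¹ ^ N) with hB
  have hB0 : 0 ≤ B := by positivity
  have hcN : 1 ≤ c⁻¹ ^ N := one_le_pow₀ ((one_le_inv₀ hc).2 hc1)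
  have hf : ContDiff ℝ ∞ fun ξ => a x y ξ * φ ξ := (ha.contDiff_right x y).mul hφ
  have hmono : ∀ ξ : Eucl (d + k), c * ρ ≤ 1 + ‖ξ‖ → (1 + ‖ξ‖) ^ m ≤ (c * ρ) ^ m := fun ξ h =>
    Real.rpow_le_rpow_of_nonpos hcρ h hm
  refine (hker ρ B (fun ξ => a x y ξ * φ ξ) hρ hB0 hf (fun ξ hξ => ?_) (fun ξ => ?_)
    (fun i ξ => ?_) (x - y)).trans (le_of_eq (by rw [hB]; ring))
  · simp only [hout ξ hξ, mul_zero]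
  · by_cases h : 1 + ‖ξ‖ < c * ρ
    · simpa only [hin ξ h, mul_zero, norm_zero] using hB0
    · calc ‖a x y ξ * φ ξ‖ ≤ C₃ * (c * ρ) ^ m * D := by
            rw [norm_mul]
            gcongr
            · exact (hbd x y ξ).trans (mul_le_mul_of_nonneg_left (hmono ξ (not_lt.1 h)) hC₃)
            · exact hφD ξ
        _ = C₃ * (D * (c * ρ) ^ m * 1) := by ring
        _ ≤ B := by
            rw [hB]
            gcongr
            exact le_add_of_nonneg_left (by positivity)
  · by_cases h : 1 + ‖ξ‖ < c * ρ
    · rw [(dirDeriv_iterate_eventuallyEq_zero (p := ξ) ?_ _ N).eq_of_nhds]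
      · simp only [Pi.zero_apply, norm_zero]; positivity
      · filter_upwards [(isOpen_lt (continuous_const.add continuous_norm)
          continuous_const).mem_nhds h] with q hq
        simp only [hin q hq, mul_zero, Pi.zero_apply]
    · have h' := not_lt.1 h
      have hle := norm_dirDeriv_iterate_mul_le_of_bounds (ha.contDiff_right x y) hφ (stdVec i) ξ N
        (fun l hl => hsym x y i l hl ξ) (fun l hl => hder i l hl ξ)
      refine hle.trans ?_
      calc _ ≤ 2 ^ N * (C₂ * (c * ρ) ^ m) * D * (c * ρ)⁻¹ ^ N := by
            have h1 := hmono ξ h'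
            generalize (1 + ‖ξ‖) ^ m = s at h1
            gcongr
        _ = 2 ^ N * C₂ * (D * (c * ρ) ^ m * c⁻¹ ^ N) * ρ⁻¹ ^ N := by
            rw [mul_inv, mul_pow]; ring
        _ ≤ B * ρ⁻¹ ^ N := by
            rw [hB]
            gcongr
            exact le_add_of_nonneg_right hC₃

/-! ### The cut-off operators -/

instance isAddRightInvariant_omegaMeasure (d k : ℕ) : (omegaMeasure d k).IsAddRightInvariant :=
  Measure.prod.instIsAddRightInvariant

/-- The Schur norm of a kernel concentrated at scale `ρ⁻¹` around the diagonal is independent of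
`ρ`. -/
theorem exists_schurBound_of_norm_le (d k : ℕ) : ∃ C : NNReal, ∀ (ρ : ℝ) (B : NNReal)
    (K : Omega d k → Omega d k → ℂ), 0 < ρ → Measurable (Function.uncurry K) →
      (∀ x y, ‖K x y‖ ≤ B * ρ ^ (d + k) * ((1 + ρ * ‖x - y‖) ^ (d + k + 1))⁻¹) →
      SchurBound (omegaMeasure d k) K (C * B) := by
  obtain ⟨C, hC⟩ := exists_lintegral_inv_one_add_scaled_le d k
  refine ⟨C, fun ρ B K hρ hK hle => ?_⟩
  refine schurBound_of_even (κ := fun z => ENNReal.ofReal (B * ρ ^ (d + k)) *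
    ENNReal.ofReal ((1 + ρ * ‖z‖) ^ (d + k + 1))⁻¹) hK (fun z => by rw [norm_neg])
    (fun x y => ?_) ?_
  · rw [← ENNReal.ofReal_mul (by positivity), ← ofReal_norm]
    exact ENNReal.ofReal_le_ofReal (hle x y)
  · rw [lintegral_const_mul _ (by fun_prop)]
    calc _ ≤ ENNReal.ofReal (B * ρ ^ (d + k)) * (C * ENNReal.ofReal (ρ⁻¹) ^ (d + k)) := by
          gcongr; exact hC ρ hρ
      _ = C * B * ENNReal.ofReal ((ρ * ρ⁻¹) ^ (d + k)) := by
          rw [ENNReal.ofReal_mul B.coe_nonneg, mul_pow, ENNReal.ofReal_mul (by positivity),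
            ENNReal.ofReal_pow (p := ρ⁻¹) (by positivity), ENNReal.ofReal_coe_nnreal]
          ring
      _ = ((C * B : NNReal) : ℝ≥0∞) := by
          rw [mul_inv_cancel₀ hρ.ne', one_pow, ENNReal.ofReal_one, mul_one, ENNReal.coe_mul]

theorem cutoff_eq_zero_of_lt (J : ℕ) (ξ : Eucl (d + k)) (h : (2 : ℝ) ^ (J + 1) < ‖ξ‖) :
    cutoff (d + k) J ξ = 0 := cutoff_eq_zero h.le

theorem one_le_two_pow_real (J : ℕ) : (1 : ℝ) ≤ 2 ^ J := one_le_pow₀ one_le_two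

theorem IsAmplitude.continuous_cutoffKernel_cutoff (ha : IsAmplitude m a) (hm : m ≤ 0) (J : ℕ) :
    Continuous (Function.uncurry (cutoffKernel a (cutoff (d + k) J))) :=
  continuous_cutoffKernel ha hm (contDiff_cutoff J).continuous (one_le_two_pow_real (J + 1))
    (norm_cutoff_le J) (cutoff_eq_zero_of_lt J)

/-- Each cut-off kernel decays off the diagonal. -/
theorem IsAmplitude.exists_norm_cutoffKernel_cutoff_le (ha : IsAmplitude m a) (hm : m ≤ 0)
    (J : ℕ) : ∃ B : NNReal, ∀ x y, ‖cutoffKernel a (cutoff (d + k) J) x y‖ ≤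
      B * (2 ^ (J + 1)) ^ (d + k) * ((1 + 2 ^ (J + 1) * ‖x - y‖) ^ (d + k + 1))⁻¹ := by
  obtain ⟨C, hC, h⟩ := ha.exists_norm_cutoffKernel_le hm
  obtain ⟨D, hD, hcut⟩ := exists_cutoff_bound (d + k) (d + k + 1)
  set ρ : ℝ := 2 ^ (J + 1) with hρ
  have hρ1 : 1 ≤ ρ := one_le_two_pow_real (J + 1)
  have hρ0 : 0 < ρ := by linarith
  have hone : ρ⁻¹ * ρ = 1 := inv_mul_cancel₀ hρ0.ne'
  -- with `c = ρ⁻¹` the lower restriction `c ρ ≤ 1 + |ξ|` on the frequencies is void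
  refine ⟨⟨C * ((D + 1) * (ρ⁻¹ * ρ) ^ m * ρ⁻¹⁻¹ ^ (d + k + 1)), by positivity⟩, fun x y => ?_⟩
  refine h ρ ρ⁻¹ (D + 1) _ hρ1 (by positivity) (inv_le_one_of_one_le₀ hρ1) (by positivity)
    (contDiff_cutoff J) (cutoff_eq_zero_of_lt J) (fun ξ hξ => ?_) (fun i l hl ξ => ?_)
    (fun ξ => (norm_cutoff_le J ξ).trans (by linarith)) x y
  · rw [hone] at hξ
    linarith [norm_nonneg ξ]
  · exact (hcut J i l hl ξ).trans (by gcongr; linarith)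

/-- The dyadic pieces have Schur norm `O(2^{Jm})`. -/
theorem IsAmplitude.exists_schurBound_sub (ha : IsAmplitude m a) (hm : m ≤ 0) :
    ∃ C : NNReal, ∀ J : ℕ, SchurBound (omegaMeasure d k)
      (fun x y => cutoffKernel a (cutoff (d + k) (J + 1)) x y -
        cutoffKernel a (cutoff (d + k) J) x y) (C * ((2 : NNReal) ^ m) ^ J) := by
  obtain ⟨C₀, hS⟩ := exists_schurBound_of_norm_le d k
  obtain ⟨C, hC, h⟩ := ha.exists_norm_cutoffKernel_le hm
  obtain ⟨D, hD, hcut⟩ := exists_cutoff_bound (d + k) (d + k + 1)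
  lift C to NNReal using hC
  lift D to NNReal using hD
  refine ⟨C₀ * (C * ((2 * D + 2) * 4 ^ (d + k + 1))), fun J => ?_⟩
  set ψ : Eucl (d + k) → ℂ := fun ξ => cutoff (d + k) (J + 1) ξ - cutoff (d + k) J ξ with hψ
  set ρ : ℝ := 2 ^ (J + 1 + 1) with hρ
  have hρ1 : 1 ≤ ρ := one_le_two_pow_real _
  have hρJ : (4 : ℝ)⁻¹ * ρ = 2 ^ J := by rw [hρ, pow_succ, pow_succ]; ring
  have hsub : ∀ x y, cutoffKernel a (cutoff (d + k) (J + 1)) x y -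
      cutoffKernel a (cutoff (d + k) J) x y = cutoffKernel a ψ x y := by
    intro x y
    simp only [cutoffKernel]
    rw [← integral_sub]
    · simp only [hψ, mul_sub, sub_mul]
    · exact integrable_cutoffIntegrand ha hm (contDiff_cutoff _).continuous
        (one_le_two_pow_real _) (norm_cutoff_le _) (cutoff_eq_zero_of_lt _) x y
    · exact integrable_cutoffIntegrand ha hm (contDiff_cutoff _).continuous
        (one_le_two_pow_real _) (norm_cutoff_le _) (cutoff_eq_zero_of_lt _) x y
  have hle : ∀ x y, ‖cutoffKernel a ψ x y‖ ≤ C * ((2 * D + 2) * (4⁻¹ * ρ) ^ m *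
      (4 : ℝ)⁻¹⁻¹ ^ (d + k + 1)) * ρ ^ (d + k) * ((1 + ρ * ‖x - y‖) ^ (d + k + 1))⁻¹ := by
    -- the difference of two cutoffs lives on `2^J ≤ |ξ| ≤ 2^{J+2} = ρ`, whence `c = 1/4`
    refine h ρ 4⁻¹ (2 * D + 2) ψ hρ1 (by norm_num) (by norm_num) (by positivity)
      ((contDiff_cutoff _).sub (contDiff_cutoff _)) (fun ξ hξ => ?_) (fun ξ hξ => ?_)
      (fun i l hl ξ => ?_) (fun ξ => ?_)
    · have h2 : (2 : ℝ) ^ (J + 1) ≤ 2 ^ (J + 1 + 1) :=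
        pow_le_pow_right₀ one_le_two (Nat.le_succ _)
      rw [hψ]
      simp only
      rw [cutoff_eq_zero hξ.le, cutoff_eq_zero (h2.trans hξ.le), sub_zero]
    · rw [hρJ] at hξ
      have h2 : (2 : ℝ) ^ J ≤ 2 ^ (J + 1) := pow_le_pow_right₀ one_le_two (Nat.le_succ _)
      have h3 : ‖ξ‖ ≤ 2 ^ J := by linarith
      rw [hψ]
      simp only
      rw [cutoff_eq_one h3, cutoff_eq_one (h3.trans h2), sub_self]
    · have hlin := congrFun (iteratedDeriv_comp_line (F := ψ)
        ((contDiff_cutoff _).sub (contDiff_cutoff _)) ξ (stdVec i) l) 0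
      have h1 := congrFun (iteratedDeriv_comp_line (contDiff_cutoff (J + 1)) ξ (stdVec i) l) 0
      have h0 := congrFun (iteratedDeriv_comp_line (contDiff_cutoff J) ξ (stdVec i) l) 0
      have hc : ∀ J', ContDiff ℝ ∞ fun t : ℝ => cutoff (d + k) J' (ξ + t • stdVec i) :=
        fun J' => (contDiff_cutoff J').comp (by fun_prop)
      have hs : (fun t : ℝ => ψ (ξ + t • stdVec i)) =
          (fun t : ℝ => cutoff (d + k) (J + 1) (ξ + t • stdVec i)) -
            fun t : ℝ => cutoff (d + k) J (ξ + t • stdVec i) := rfl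
      rw [hs, iteratedDeriv_sub ((hc _).contDiffAt.of_le (by exact_mod_cast le_top))
        ((hc _).contDiffAt.of_le (by exact_mod_cast le_top)), h1, h0] at hlin
      simp only [zero_smul, add_zero] at hlin
      rw [← hlin]
      have hp : 0 ≤ (1 + ‖ξ‖)⁻¹ ^ l := by positivity
      refine (norm_sub_le _ _).trans ((add_le_add (hcut _ i l hl ξ) (hcut _ i l hl ξ)).trans ?_)
      nlinarith
    · refine (norm_sub_le _ _).trans
        ((add_le_add (norm_cutoff_le _ ξ) (norm_cutoff_le _ ξ)).trans ?_)
      linarith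
  simp only [hsub]
  have hpow : ((2 : ℝ) ^ J) ^ m = ((2 : ℝ) ^ m) ^ J := by
    rw [← Real.rpow_natCast, ← Real.rpow_natCast, ← Real.rpow_mul zero_le_two,
      ← Real.rpow_mul zero_le_two, mul_comm]
  rw [mul_assoc]
  refine hS ρ _ _ (by linarith) ?_ fun x y => (hle x y).trans (le_of_eq ?_)
  · have := (ha.continuous_cutoffKernel_cutoff hm (J + 1)).sub
      (ha.continuous_cutoffKernel_cutoff hm J)
    simp only [Pi.sub_def, Function.uncurry_def, hsub] at this
    exact this.measurable
  · rw [hρJ, hpow, inv_inv]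
    push_cast
    ring

/-- The smallness hypothesis at infinity, near the diagonal, passes to the cut-off kernels: on the
bounded set of frequencies involved, the weight of `decaySup` is bounded below. -/
theorem IsAmplitude.cutoffKernel_near_diagonal (ha : IsAmplitude m a) (hm : m ≤ 0)
    (hdecay : ∀ R : ℝ, 0 < R → Tendsto (fun p : Omega d k × Omega d k => decaySup m a p.1 p.2)
      (nearDiagInfty d k R) (𝓝 0)) (J : ℕ) (R ε : ℝ) (hR : 0 < R) (hε : 0 < ε) :
    ∃ S : Set (Omega d k), IsCompact S ∧ ∀ x y, ¬ (x ∈ S ∧ y ∈ S) → dist x y < R →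
      ‖cutoffKernel a (cutoff (d + k) J) x y‖ ≤ ε := by
  obtain ⟨A, hA0, hA⟩ := exists_integral_norm_le_of_support d k
  set ρ : ℝ := 2 ^ (J + 1) with hρ
  have hρ1 : 1 ≤ ρ := one_le_two_pow_real _
  have hρ0 : 0 < ρ := by linarith
  set b : ℝ := ε / (A * ρ ^ (d + k) + 1) with hb
  have hb0 : 0 < b := by positivity
  set ε₁ : ℝ := b * (1 + ρ) ^ m with hε₁
  have hε₁0 : 0 < ε₁ := by positivity
  have hev := (hdecay R hR).eventually (ge_mem_nhds (ENNReal.ofReal_pos.2 hε₁0))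
  rw [nearDiagInfty, eventually_inf_principal, eventually_prod_iff] at hev
  obtain ⟨p, hp, q, hq, hpq⟩ := hev
  obtain ⟨S₁, hS₁, hS₁p⟩ := mem_cocompact.1 hp
  obtain ⟨S₂, hS₂, hS₂q⟩ := mem_cocompact.1 hq
  obtain ⟨M, hM⟩ := (hS₁.union hS₂).isBounded.subset_closedBall 0
  refine ⟨Metric.closedBall 0 (M + R), isCompact_closedBall _ _, fun x y hxy hd => ?_⟩
  -- two points at distance less than `R`, one outside the larger ball: both are outside the smaller
  have hfar : M < ‖x‖ ∧ M < ‖y‖ := by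
    have h1 : ‖x‖ ≤ ‖y‖ + dist x y := by
      rw [dist_eq_norm]; linarith [norm_sub_norm_le x y]
    have h2 : ‖y‖ ≤ ‖x‖ + dist x y := by
      rw [dist_comm, dist_eq_norm]; linarith [norm_sub_norm_le y x]
    simp only [mem_closedBall_zero_iff, not_and_or, not_le] at hxy
    rcases hxy with h | h <;> constructor <;> linarith
  have hx : p x := hS₁p fun h => by
    have := hM (Or.inl h)
    rw [mem_closedBall_zero_iff] at this
    linarith [hfar.1]
  have hy : q y := hS₂q fun h => by
    have := hM (Or.inr h)
    rw [mem_closedBall_zero_iff] at this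
    linarith [hfar.2]
  have hsup : decaySup m a x y ≤ ENNReal.ofReal ε₁ := hpq hx hy hd
  have hab : ∀ ξ : Eucl (d + k), ‖ξ‖ ≤ ρ → ‖a x y ξ‖ ≤ b := by
    intro ξ hξ
    have h1 : ENNReal.ofReal ((1 + ‖ξ‖) ^ m * ‖a x y ξ‖) ≤ ENNReal.ofReal ε₁ := by
      refine le_trans ?_ hsup
      have := le_iSup_of_le (f := fun ξ : Eucl (d + k) => ⨆ (α : Fin (d + k) → ℕ)
        (_ : order α ≤ d + k + 1), ENNReal.ofReal ((1 + ‖ξ‖) ^ ((order α : ℝ) + m) *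
          ‖partialDeriv α (a x y) ξ‖)) ξ (le_iSup₂_of_le (0 : Fin (d + k) → ℕ)
            (by simp [order_zero]) le_rfl)
      rw [order_zero, Nat.cast_zero, zero_add, partialDeriv, multiDeriv_zero] at this
      exact this
    rw [ENNReal.ofReal_le_ofReal_iff hε₁0.le, hε₁] at h1
    have h2 : (1 + ρ) ^ m ≤ (1 + ‖ξ‖) ^ m :=
      Real.rpow_le_rpow_of_nonpos (by positivity) (by linarith) hm
    have h3 : 0 < (1 + ρ) ^ m := by positivity
    have h4 : (1 + ρ) ^ m * ‖a x y ξ‖ ≤ (1 + ρ) ^ m * b := by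
      calc _ ≤ (1 + ‖ξ‖) ^ m * ‖a x y ξ‖ := mul_le_mul_of_nonneg_right h2 (norm_nonneg _)
        _ ≤ _ := by rw [mul_comm _ b]; exact h1
    exact le_of_mul_le_mul_left h4 h3
  have hint := (hA (fun ξ => a x y (dualIncl ξ) * cutoff (d + k) J (dualIncl ξ) *
    character (x - y) ξ) ρ b
    ((continuous_cutoffIntegrand ha (contDiff_cutoff J).continuous).comp
      (Continuous.prodMk_right (x, y))).aestronglyMeasurable hρ1 (fun ξ => by
        rw [norm_mul, norm_mul, norm_character, mul_one]
        by_cases h : ‖dualIncl ξ‖ ≤ ρ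
        · calc _ ≤ b * 1 := mul_le_mul (hab _ h) (norm_cutoff_le _ _) (norm_nonneg _) hb0.le
            _ = b := mul_one b
        · rw [cutoff_eq_zero_of_lt J _ (not_le.1 h), norm_zero, mul_zero]
          exact hb0.le) (fun ξ h => by
        rw [cutoff_eq_zero_of_lt J _ h, mul_zero, zero_mul])).2
  refine (norm_integral_le_integral_norm _).trans (hint.trans ?_)
  rw [hb, mul_div_assoc', div_le_iff₀ (by positivity)]
  nlinarith

/-- The operator with the cut-off kernel exists and is compact. -/
theorem IsAmplitude.exists_compact_cutoff (ha : IsAmplitude m a) (hm : m ≤ 0)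
    (hdecay : ∀ R : ℝ, 0 < R → Tendsto (fun p : Omega d k × Omega d k => decaySup m a p.1 p.2)
      (nearDiagInfty d k R) (𝓝 0)) (J : ℕ) :
    ∃ T : L2 d k →L[ℂ] L2 d k,
      IsKernelOp (omegaMeasure d k) (cutoffKernel a (cutoff (d + k) J)) T ∧
        IsCompactOperator T := by
  obtain ⟨C₀, hS⟩ := exists_schurBound_of_norm_le d k
  obtain ⟨C₁, hC₁⟩ := exists_lintegral_inv_one_add_scaled_le d k
  obtain ⟨B, hB⟩ := ha.exists_norm_cutoffKernel_cutoff_le hm J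
  have hcont := ha.continuous_cutoffKernel_cutoff hm J
  have hpos : (0 : ℝ) < 2 ^ (J + 1) := by positivity
  obtain ⟨T, hT, -⟩ := (hS _ B _ hpos hcont.measurable hB).exists_isKernelOp
  refine ⟨T, hT, isCompactOperator_of_tight hcont hT fun ε hε => ?_⟩
  refine exists_schurBound_off_compact (κ := fun z =>
    ENNReal.ofReal (B * (2 ^ (J + 1)) ^ (d + k)) *
      ENNReal.ofReal ((1 + 2 ^ (J + 1) * ‖z‖) ^ (d + k + 1))⁻¹) hcont.measurable (by fun_prop)
    (fun z => by rw [norm_neg]) (fun x y => ?_) ?_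
    (ha.cutoffKernel_near_diagonal hm hdecay J) hε
  · rw [← ENNReal.ofReal_mul (by positivity), ← ofReal_norm]
    exact ENNReal.ofReal_le_ofReal (hB x y)
  · rw [lintegral_const_mul _ (by fun_prop)]
    exact ENNReal.mul_ne_top ENNReal.ofReal_ne_top ((hC₁ _ hpos).trans_lt
      (ENNReal.mul_lt_top ENNReal.coe_lt_top (ENNReal.pow_lt_top ENNReal.ofReal_lt_top))).ne

/-! ### The iterated integral on Schwartz functions -/

variable {u : Omega d k → ℂ}

theorem IsSchwartz.continuous (hu : IsSchwartz u) : Continuous u :=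
  (isOpenQuotientMap_proj d k).continuous_comp_iff.1 hu.smooth.continuous

theorem IsSchwartz.exists_norm_le (hu : IsSchwartz u) : ∃ C : ℝ, 0 ≤ C ∧
    ∀ y, ‖u y‖ ≤ C * ((1 + ‖y.2‖) ^ (k + 1))⁻¹ := by
  obtain ⟨C, hC⟩ := hu.decay 0 (k + 1)
  refine ⟨max C 0, le_max_right _ _, fun y => ?_⟩
  obtain ⟨y, rfl⟩ := (isOpenQuotientMap_proj d k).surjective y
  have h := hC y
  rw [partialDeriv, multiDeriv_zero] at h
  rw [← div_eq_mul_inv, le_div_iff₀ (by positivity), mul_comm]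
  exact h.trans (le_max_left _ _)

theorem IsSchwartz.exists_norm_dirDeriv_le (hu : IsSchwartz u) : ∃ C : ℝ, 0 ≤ C ∧
    ∀ i, ∀ l ≤ d + k + 1, ∀ y, ‖((dirDeriv (stdVec i))^[l] fun z => u (proj d k z)) y‖ ≤
      C * ((1 + ‖(proj d k y).2‖) ^ (k + 1))⁻¹ := by
  obtain ⟨C, hC0, hC⟩ := exists_common_bound (n := d + k) (N := d + k + 1)
    (f := fun i l y => (1 + ‖(proj d k y).2‖) ^ (k + 1) *
      ‖((dirDeriv (stdVec i))^[l] fun z => u (proj d k z)) y‖) fun i l _ => by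
      obtain ⟨C, hC⟩ := hu.decay (Pi.single i l) (k + 1)
      exact ⟨C, by simpa only [partialDeriv, multiDeriv_single] using hC⟩
  refine ⟨C, hC0, fun i l hl y => ?_⟩
  rw [← div_eq_mul_inv, le_div_iff₀ (by positivity), mul_comm]
  exact hC i l hl y

theorem IsSchwartz.integrable (hu : IsSchwartz u) : Integrable u (omegaMeasure d k) := by
  obtain ⟨C, -, hC⟩ := hu.exists_norm_le
  exact ((integrable_inv_one_add_snd d k).const_mul C).mono' hu.continuous.aestronglyMeasurable
    (ae_of_all _ hC)

theorem IsSchwartz.memLp_two (hu : IsSchwartz u) : MemLp u 2 (omegaMeasure d k) := by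
  obtain ⟨C, hC0, hC⟩ := hu.exists_norm_le
  rw [memLp_two_iff_integrable_sq_norm hu.continuous.aestronglyMeasurable]
  refine ((hu.integrable.norm).const_mul C).mono' (hu.continuous.norm.pow 2).aestronglyMeasurable
    (ae_of_all _ fun y => ?_)
  rw [norm_pow, norm_norm, sq]
  refine mul_le_mul_of_nonneg_right ((hC y).trans ?_) (norm_nonneg _)
  exact mul_le_of_le_one_right hC0 (inv_le_one_of_one_le₀ (one_le_pow₀ (by simp)))

theorem character_proj (w : Eucl (d + k)) (ξ : OmegaDual d k) :
    character (proj d k w) ξ =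
      Complex.exp (Complex.I * ((∑ i, w i * dualIncl ξ i : ℝ) : ℂ)) := by
  have h2 : (Real.pi : ℂ) ≠ 0 := by exact_mod_cast Real.pi_pos.ne'
  rw [Fin.sum_univ_add, Complex.ofReal_add, mul_add, Complex.exp_add]
  simp only [dualIncl_castAdd, dualIncl_natAdd, character]
  congr 1
  · rw [Complex.ofReal_sum, Finset.mul_sum, Complex.exp_sum]
    refine Finset.prod_congr rfl fun i _ => ?_
    simp only [proj]
    rw [fourier_coe_apply]
    congr 1
    push_cast
    field_simp
  · congr 3
    simp [proj, PiLp.inner_apply, mul_comm]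

theorem character_proj_smul_stdVec (h : ℝ) (i : Fin (d + k)) (ξ : OmegaDual d k) :
    character (proj d k (h • stdVec i)) ξ =
      Complex.exp (Complex.I * ((h * dualIncl ξ i : ℝ) : ℂ)) := by
  rw [character_proj]
  congr 3
  rw [Finset.sum_eq_single i]
  · simp [stdVec]
  · intro j _ hj
    simp [stdVec, hj]
  · simp

theorem norm_proj_snd_le (w : Eucl (d + k)) : ‖(proj d k w).2‖ ≤ ‖w‖ := by
  rw [EuclideanSpace.norm_eq, EuclideanSpace.norm_eq]
  refine Real.sqrt_le_sqrt ?_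
  rw [Fin.sum_univ_add]
  simp only [proj]
  exact le_add_of_nonneg_left (Finset.sum_nonneg fun _ _ => sq_nonneg _)

theorem continuous_integrand (ha : IsAmplitude m a) (hu : Continuous u) (x : Omega d k) :
    Continuous fun p : OmegaDual d k × Omega d k => integrand a u x p.1 p.2 := by
  have h1 : Continuous fun p : OmegaDual d k × Omega d k => dualIncl p.1 :=
    continuous_dualIncl.comp continuous_fst
  have h2 := ha.continuous.comp ((continuous_const (y := x)).prodMk (continuous_snd.prodMk h1))
  have h3 := continuous_character.comp (((continuous_const (y := x)).sub
    continuous_snd).prodMk continuous_fst :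
    Continuous fun p : OmegaDual d k × Omega d k => (x - p.2, p.1))
  exact (h2.mul h3).mul (hu.comp continuous_snd)

theorem integrable_integrand (ha : IsAmplitude m a) (hm : m ≤ 0) (hu : IsSchwartz u)
    (x : Omega d k) (ξ : OmegaDual d k) :
    Integrable (integrand a u x ξ) (omegaMeasure d k) := by
  obtain ⟨C, hC0, hC⟩ := ha.exists_norm_le hm
  refine (hu.integrable.norm.const_mul C).mono' ((continuous_integrand ha hu.continuous x).comp
    (Continuous.prodMk_right ξ)).aestronglyMeasurable (ae_of_all _ fun y => ?_)
  rw [integrand, norm_mul, norm_mul, norm_character, mul_one]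
  exact mul_le_mul_of_nonneg_right (hC _ _ _) (norm_nonneg _)

/-- Differences in `y` of `a(x,y,ξ) u(y)`, uniformly in `x` and `ξ`: the weight
`(1 + |y''|)^{-(k+1)}` changes by a bounded factor along a segment of length at most `n + 1`. -/
theorem exists_norm_fwdDiff_amplitude_mul_le (ha : IsAmplitude m a) (hm : m ≤ 0)
    (hu : IsSchwartz u) : ∃ B : ℝ, 0 ≤ B ∧ ∀ (x : Omega d k) (ξ : Eucl (d + k)) (i : Fin (d + k))
      (h : ℝ), 0 ≤ h → h ≤ 1 → ∀ y,
      ‖((fwdDiff (proj d k (h • stdVec i)))^[d + k + 1] fun y => a x y ξ * u y) y‖ ≤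
        h ^ (d + k + 1) * (B * ((1 + ‖y.2‖) ^ (k + 1))⁻¹) := by
  obtain ⟨C₁, hC₁, ha1⟩ := ha.exists_bound_mid hm
  obtain ⟨C₂, hC₂, hu2⟩ := hu.exists_norm_dirDeriv_le
  set N := d + k + 1 with hN
  refine ⟨2 ^ N * C₁ * (C₂ * (1 + N) ^ (k + 1)), by positivity, fun x ξ i h hh0 hh1 y => ?_⟩
  obtain ⟨y, rfl⟩ := (isOpenQuotientMap_proj d k).surjective y
  have heq := congrFun (fwdDiff_iterate_comp (φ := proj d k) (h := h • stdVec i)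
    (fun x => proj_add x _) (fun y => a x y ξ * u y) N) y
  rw [← heq]
  have hs1 := ha.contDiff_mid x ξ
  refine norm_fwdDiff_iterate_le (hs1.mul hu.smooth) y (stdVec i) hh0 N fun t ht => ?_
  have hL := norm_dirDeriv_iterate_mul_le_of_bounds (s := 1) hs1 hu.smooth (stdVec i)
    (y + t • stdVec i) N (A := C₁)
    (B := C₂ * ((1 + ‖(proj d k (y + t • stdVec i)).2‖) ^ (k + 1))⁻¹)
    (fun l hl => by rw [one_pow, mul_one]; exact ha1 x _ i l hl _)
    (fun l hl => by rw [one_pow, mul_one]; exact hu2 i l hl _)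
  refine hL.trans ?_
  have htN : t ≤ N := ht.2.trans (mul_le_of_le_one_right (Nat.cast_nonneg N) hh1)
  have hshift : ‖(proj d k y).2‖ ≤ ‖(proj d k (y + t • stdVec i)).2‖ + N := by
    have e : (proj d k y).2 = (proj d k (y + t • stdVec i)).2 -
        (proj d k (t • stdVec i)).2 := by
      rw [proj_add, Prod.snd_add, add_sub_cancel_right]
    have h3 : ‖(proj d k (t • stdVec i)).2‖ ≤ N := by
      refine (norm_proj_snd_le _).trans ?_
      rw [norm_smul, stdVec, PiLp.norm_single, norm_one, mul_one, Real.norm_of_nonneg ht.1]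
      exact htN
    rw [e]
    exact (norm_sub_le _ _).trans (by linarith)
  have hw : ((1 + ‖(proj d k (y + t • stdVec i)).2‖) ^ (k + 1))⁻¹ ≤
      (1 + N) ^ (k + 1) * ((1 + ‖(proj d k y).2‖) ^ (k + 1))⁻¹ := by
    rw [← div_eq_mul_inv, le_div_iff₀ (by positivity), ← div_eq_inv_mul,
      div_le_iff₀ (by positivity), ← mul_pow]
    refine pow_le_pow_left₀ (by positivity) ?_ _
    have := norm_nonneg (proj d k (y + t • stdVec i)).2
    have hN0 : (0 : ℝ) ≤ N := Nat.cast_nonneg N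
    nlinarith
  rw [one_pow, mul_one]
  calc _ ≤ 2 ^ N * C₁ * (C₂ * ((1 + N) ^ (k + 1) *
        ((1 + ‖(proj d k y).2‖) ^ (k + 1))⁻¹)) := by gcongr
    _ = _ := by ring

theorem continuous_character_neg (ξ : OmegaDual d k) :
    Continuous fun y : Omega d k => character (-y) ξ :=
  have h : Continuous fun y : Omega d k => (-y, ξ) := by fun_prop
  (continuous_character.comp h :)

/-- The inner integral decays like `(1 + |ξ|)^{-(n+1)}`: summation by parts in `y`, with
differences of a step so small that the phase stays below `π`. -/
theorem exists_norm_integral_integrand_le (ha : IsAmplitude m a) (hm : m ≤ 0)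
    (hu : IsSchwartz u) : ∃ M : ℝ, ∀ (x : Omega d k) (ξ : OmegaDual d k),
      ‖∫ y, integrand a u x ξ y ∂omegaMeasure d k‖ ≤
        M * ((1 + ‖dualIncl ξ‖) ^ (d + k + 1))⁻¹ := by
  obtain ⟨C₀, hC₀, ha0⟩ := ha.exists_norm_le hm
  obtain ⟨B, hB0, hdiff⟩ := exists_norm_fwdDiff_amplitude_mul_le ha hm hu
  set N := d + k + 1 with hN
  set W : ℝ := ∫ y : Omega d k, ((1 + ‖y.2‖) ^ (k + 1))⁻¹ ∂omegaMeasure d k with hW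
  set U : ℝ := ∫ y, ‖u y‖ ∂omegaMeasure d k with hU
  refine ⟨2 ^ (d + k) * (C₀ * U + ((d + k : ℕ) : ℝ) ^ N * ((Real.pi / 2) ^ N * (B * W))),
    fun x ξ => ?_⟩
  set I := ∫ y, integrand a u x ξ y ∂omegaMeasure d k with hI
  set g : Omega d k → ℂ := fun y => a x y (dualIncl ξ) * u y with hg
  have hgc : Continuous g := (ha.continuous.comp ((continuous_const (y := x)).prodMk
    (continuous_id.prodMk (continuous_const (y := dualIncl ξ))))).mul hu.continuous
  have hgle : ∀ y, ‖g y‖ ≤ C₀ * ‖u y‖ := fun y => by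
    rw [hg, norm_mul]
    exact mul_le_mul_of_nonneg_right (ha0 _ _ _) (norm_nonneg _)
  have hgint : Integrable g (omegaMeasure d k) :=
    (hu.integrable.norm.const_mul C₀).mono' hgc.aestronglyMeasurable (ae_of_all _ hgle)
  have hchar : Continuous fun y : Omega d k => character (-y) ξ :=
    continuous_character_neg ξ
  have hIg : ‖I‖ = ‖∫ y, g y * character (-y) ξ ∂omegaMeasure d k‖ := by
    have : I = character x ξ * ∫ y, g y * character (-y) ξ ∂omegaMeasure d k := by
      rw [← integral_const_mul]
      refine integral_congr_ae (ae_of_all _ fun y => ?_)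
      simp only [integrand, hg, sub_eq_add_neg, character_add_left]
      ring
    rw [this, norm_mul, norm_character, one_mul]
  have htriv : ‖I‖ ≤ C₀ * U := by
    rw [hIg, hU, ← integral_const_mul]
    refine (norm_integral_le_integral_norm _).trans ?_
    simp only [norm_mul (g _), norm_character, mul_one]
    exact integral_mono hgint.norm (hu.integrable.norm.const_mul C₀) hgle
  have hcoord : ∀ i : Fin (d + k),
      |dualIncl ξ i| ^ N * ‖I‖ ≤ (Real.pi / 2) ^ N * (B * W) := by
    intro i
    obtain ⟨h, hh0, hh1, hhπ⟩ := exists_step (dualIncl ξ i)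
    refine pow_mul_le_of_scaled hh0 ?_
    have hle := mul_norm_integral_mul_le (e := fun y => character (-y) ξ) hgint hchar.measurable
      (fun y z => by rw [neg_add, character_add_left]) (fun y => norm_character _ _)
      (v := proj d k (h • stdVec i)) (θ := h * dualIncl ξ i)
      (by rwa [abs_mul, abs_of_pos hh0])
      (by rw [neg_neg, character_proj_smul_stdVec]) N
    rw [← hIg, abs_mul, abs_of_pos hh0] at hle
    refine hle.trans ?_
    calc _ ≤ ∫ y : Omega d k, h ^ N * (B * ((1 + ‖y.2‖) ^ (k + 1))⁻¹) ∂omegaMeasure d k :=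
          integral_mono (integrable_fwdDiff_iterate hgint _ N).norm
            (((integrable_inv_one_add_snd d k).const_mul B).const_mul _)
            (hdiff x (dualIncl ξ) i h hh0.le hh1)
      _ = _ := by rw [integral_const_mul, integral_const_mul]
  have hz := pow_mul_le_of_le_sum (n := d + k) (c := fun i => |dualIncl ξ i|) (X := ‖I‖)
    (fun _ => abs_nonneg _) (norm_nonneg _) (norm_le_sum_abs (dualIncl ξ)) (norm_nonneg I) hcoord
  rw [Fintype.card_fin] at hz
  rw [← div_eq_mul_inv, le_div_iff₀ (by positivity), mul_comm]
  have hbin := add_pow_le (zero_le_one) (norm_nonneg (dualIncl ξ)) N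
  rw [one_pow, hN, Nat.add_sub_cancel, ← hN] at hbin
  calc (1 + ‖dualIncl ξ‖) ^ N * ‖I‖ ≤ 2 ^ (d + k) * (1 + ‖dualIncl ξ‖ ^ N) * ‖I‖ := by gcongr
    _ = 2 ^ (d + k) * (‖I‖ + ‖dualIncl ξ‖ ^ N * ‖I‖) := by ring
    _ ≤ _ := by gcongr

theorem integrable_integral_integrand (ha : IsAmplitude m a) (hm : m ≤ 0) (hu : IsSchwartz u)
    (x : Omega d k) :
    Integrable (fun ξ => ∫ y, integrand a u x ξ y ∂omegaMeasure d k) (dualMeasure d k) := by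
  obtain ⟨M, hM⟩ := exists_norm_integral_integrand_le ha hm hu
  refine ((integrable_inv_one_add_dual d k).const_mul M).mono' ?_ (ae_of_all _ fun ξ => hM x ξ)
  exact (StronglyMeasurable.integral_prod_right'
    (f := fun p : OmegaDual d k × Omega d k => integrand a u x p.1 p.2)
    (continuous_integrand ha hu.continuous x).stronglyMeasurable).aestronglyMeasurable

theorem pdoConverges (ha : IsAmplitude m a) (hm : m ≤ 0) (hu : IsSchwartz u) (x : Omega d k) :
    PdoConverges a u x :=
  ⟨integrable_integrand ha hm hu x, integrable_integral_integrand ha hm hu x⟩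

/-- With a frequency cutoff the order of integration may be exchanged. -/
theorem integral_cutoffKernel_mul (ha : IsAmplitude m a) (hm : m ≤ 0) (hu : IsSchwartz u) (J : ℕ)
    (x : Omega d k) :
    ∫ y, cutoffKernel a (cutoff (d + k) J) x y * u y ∂omegaMeasure d k =
      ∫ ξ, cutoff (d + k) J (dualIncl ξ) *
        ∫ y, integrand a u x ξ y ∂omegaMeasure d k ∂dualMeasure d k := by
  obtain ⟨C, hC0, hC⟩ := ha.exists_norm_le hm
  obtain ⟨A, -, hA⟩ := exists_integral_norm_le_of_support d k
  have hcutc : Continuous fun ξ : OmegaDual d k => cutoff (d + k) J (dualIncl ξ) :=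
    (contDiff_cutoff J).continuous.comp continuous_dualIncl
  have hcut : Integrable (fun ξ : OmegaDual d k => cutoff (d + k) J (dualIncl ξ))
      (dualMeasure d k) :=
    (hA _ (2 ^ (J + 1)) 1 hcutc.aestronglyMeasurable (one_le_two_pow_real _)
      (fun _ => norm_cutoff_le _ _) fun ξ => cutoff_eq_zero_of_lt J _).1
  have hint : Integrable (Function.uncurry fun (y : Omega d k) (ξ : OmegaDual d k) =>
      cutoff (d + k) J (dualIncl ξ) * integrand a u x ξ y)
      ((omegaMeasure d k).prod (dualMeasure d k)) := by
    refine ((hu.integrable.norm.const_mul C).mul_prod hcut.norm).mono' ?_ (ae_of_all _ ?_)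
    · exact ((hcutc.comp continuous_snd).mul
        ((continuous_integrand ha hu.continuous x).comp continuous_swap)).aestronglyMeasurable
    · rintro ⟨y, ξ⟩
      simp only [Function.uncurry_apply_pair]
      rw [integrand, norm_mul, norm_mul, norm_mul, norm_character, mul_one, mul_comm]
      gcongr
      exact hC _ _ _
  calc _ = ∫ y, ∫ ξ, cutoff (d + k) J (dualIncl ξ) * integrand a u x ξ y
        ∂dualMeasure d k ∂omegaMeasure d k := by
        refine integral_congr_ae (ae_of_all _ fun y => ?_)
        simp only [cutoffKernel]
        rw [← integral_mul_const]
        refine integral_congr_ae (ae_of_all _ fun ξ => ?_)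
        simp only [integrand]
        ring
    _ = ∫ ξ, ∫ y, cutoff (d + k) J (dualIncl ξ) * integrand a u x ξ y
        ∂omegaMeasure d k ∂dualMeasure d k := integral_integral_swap hint
    _ = _ := by simp only [integral_const_mul]

/-- Removal of the cutoff, by dominated convergence in the frequency variable. -/
theorem tendsto_integral_cutoffKernel_mul (ha : IsAmplitude m a) (hm : m ≤ 0) (hu : IsSchwartz u)
    (x : Omega d k) :
    Tendsto (fun J => ∫ y, cutoffKernel a (cutoff (d + k) J) x y * u y ∂omegaMeasure d k) atTop
      (𝓝 (pdo a u x)) := by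
  simp only [integral_cutoffKernel_mul ha hm hu]
  have hint := integrable_integral_integrand ha hm hu x
  refine tendsto_integral_of_dominated_convergence _ (fun J => ?_) hint.norm (fun J => ?_) ?_
  · exact ((contDiff_cutoff J).continuous.comp continuous_dualIncl).aestronglyMeasurable.mul
      hint.aestronglyMeasurable
  · refine ae_of_all _ fun ξ => ?_
    rw [norm_mul]
    exact mul_le_of_le_one_left (norm_nonneg _) (norm_cutoff_le _ _)
  · refine ae_of_all _ fun ξ => ?_
    simpa only [one_mul] using (tendsto_cutoff (dualIncl ξ)).mul_const
      (∫ y, integrand a u x ξ y ∂omegaMeasure d k)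

end Amplitude

end MixedPDO

end

theorem theorem2p1 (d k : ℕ) (hd : 1 ≤ d) (hk : 1 ≤ k) (m : ℝ) (hm : m < 0)
    (a : MixedPDO.Omega d k → MixedPDO.Omega d k → MixedPDO.Eucl (d + k) → ℂ)
    (ha : MixedPDO.IsAmplitude m a)
    (hdecay : ∀ R : ℝ, 0 < R →
      Tendsto (fun p : MixedPDO.Omega d k × MixedPDO.Omega d k =>
        MixedPDO.decaySup m a p.1 p.2) (MixedPDO.nearDiagInfty d k R) (𝓝 0)) :
    ∃ T : MixedPDO.L2 d k →L[ℂ] MixedPDO.L2 d k,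
      MixedPDO.IsL2Extension a T ∧ IsCompactOperator T := by
  choose T hT hTc using ha.exists_compact_cutoff hm.le hdecay
  obtain ⟨C, hC⟩ := ha.exists_schurBound_sub hm.le
  have hr : (2 : NNReal) ^ m < 1 := NNReal.rpow_lt_one_of_one_lt_of_neg one_lt_two hm
  have hdist : ∀ J, dist (T J) (T (J + 1)) ≤ C * ((2 : NNReal) ^ m : NNReal) ^ J := by
    intro J
    rw [dist_comm, dist_eq_norm]
    exact_mod_cast ((hT (J + 1)).sub (hT J)).norm_le (hC J)
  obtain ⟨S, hS⟩ := cauchySeq_tendsto_of_complete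
    (cauchySeq_of_le_geometric _ _ (by exact_mod_cast hr) hdist)
  refine ⟨S, fun u hu => ⟨MixedPDO.pdoConverges ha hm.le hu, hu.memLp_two, ?_⟩,
    isCompactOperator_of_tendsto hS (Eventually.of_forall hTc)⟩
  -- along a subsequence, the cut-off operators converge almost everywhere on `u`
  have hlim : Tendsto (fun J => T J (hu.memLp_two.toLp u)) atTop (𝓝 (S (hu.memLp_two.toLp u))) :=
    ((ContinuousLinearMap.apply ℂ _ (hu.memLp_two.toLp u)).continuous.tendsto S).comp hS
  obtain ⟨ns, hns, hae⟩ := (tendstoInMeasure_of_tendsto_Lp hlim).exists_seq_tendsto_ae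
  filter_upwards [hae, ae_all_iff.2 fun J => hT J (hu.memLp_two.toLp u)] with x hx hTx
  refine tendsto_nhds_unique hx ?_
  refine ((MixedPDO.tendsto_integral_cutoffKernel_mul ha hm.le hu x).comp
    hns.tendsto_atTop).congr fun j => ?_
  rw [Function.comp_apply, (hTx (ns j)).2]
  refine integral_congr_ae ?_
  filter_upwards [hu.memLp_two.coeFn_toLp] with y hy
  rw [hy]
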